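/- **Setting.** Let $d\ge 1$ and $T\ge 0$ be integers, let $K_t^j\subseteq\mathbb R$ ($0\le t\le T$, $1\le j\le d$) be closed, and put $K_t=\prod_{j=1}^d K_t^j$, $\Omega_{0:t}=K_0\times\dots\times K_t$, $\Omega=\Omega_{0:T}$. Write $x=(x_t^j)_{t,j}$, $x_t=(x_t^1,\dots,x_t^d)$ for the points of $\Omega$, and $X_t^j(x)=x_t^j$ for the canonical process. Let $$C_t=\Big\{\phi:K_t\to\mathbb R \text{ continuous}\;:\;\sup_{y\in K_t}\frac{|\phi(y)|}{1+\sum_{j}|y^j|}<\infty\Big\}.$$ A strategy $\Delta\in\mathcal H$ consists of bounded continuous functions $\Delta_t^j:\Omega_{0:t}\to\mathbb R$ ($0\le t\le T-1$, $1\le j\le d$), and $I^\Delta(x)=\sum_{t=0}^{T-1}\sum_{j=1}^d\Delta_t^j(x_0,\dots,x_t)(x_{t+1}^j-x_t^j)$. $\mathrm{Mart}(\Omega)$ is the set of Borel probability measures on $\Omega$ under which each $(X_t^j)_{t}$ is a martingale in the natural filtration of the canonical process; $Q_t$ denotes the marginal of $Q$ on $K_t$. **Hypotheses.** For every $t$ let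 $\mathcal E_t\subseteq C_t$ be a vector subspace containing the constants and the coordinate functions $X_t^1,\dots,X_t^d$, and let $S_t:\mathcal E_t\to\mathbb R$ be concave and cash additive ($S_t(\phi+b)=S_t(\phi)+b$ for $b\in\mathbb R$), with $S_t(0)=0$. Let $\mathcal E=\mathcal E_0\times\dots\times\mathcal E_T$, $U(\varphi)=\sum_{t=0}^T S_t(\varphi_t)$ and $V(\varphi)=-U(-\varphi)$ for $\varphi\in\mathcal E$. Assume that for every $t$ there are compact sets $\mathfrak K_t(n)\subseteq K_t$ and functions $0\le f_t^n\in\mathcal E_t$, $n\ge1$, such that, for every $n$, $$1+\sum_{t=0}^T\sum_{j=1}^d|x_t^j|\le\sum_{t=0}^T f_t^n(x_t)\qquad\text{for all }x\in\Omega\setminus\big(\mathfrak K_0(n)\times\dots\times\mathfrak K_T(n)\big),$$ and $V(\Gamma f_0^n,\dots,\Gamma f_T^n)\to0$ as $n\to\infty$ for every real $\Gamma>0$. Let $c:\Omega\to(-\infty,+\infty]$ be lower semicontinuous with $c(x)\ge-A\big(1+\sum_{t,j}|x_t^j|\big)$ for all $x\in\Omega$, for some $A\in[0,\infty)$. **Definitions.**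 For $\varphi\in\mathcal E$ let $S^U(\varphi)=\sup_{\beta\in\mathbb R^{T+1}}\big(U(\varphi+\beta)-\sum_{t}\beta_t\big)$, let $\mathcal I=\{I^\Delta:\Delta\in\mathcal H\}$, and let $$\mathfrak P(c)=\sup\Big\{S^U(\varphi)\;:\;z\in-\mathcal I,\ \varphi\in\mathcal E,\ S^U(\varphi)>-\infty,\ \sum_{t}\varphi_t(x_t)+z(x)\le c(x)\ \ \forall x\in\Omega\Big\}.$$ For $Q\in\mathrm{Mart}(\Omega)$ let $\mathcal D_t(Q_t)=\sup_{\varphi_t\in\mathcal E_t}\big(S_t(\varphi_t)-\int_{K_t}\varphi_t\,dQ_t\big)\in[0,+\infty]$. **Theorem.** With $\sup\emptyset=-\infty$ and $\inf\emptyset=+\infty$, $$\mathfrak P(c)=\sup\Big\{\sum_{t=0}^T S_t(\varphi_t)\;:\;\varphi\in\mathcal E,\ \exists\,\Delta\in\mathcal H\text{ with }\sum_{t=0}^T\varphi_t(x_t)+I^\Delta(x)\le c(x)\ \ \forall x\in\Omega\Big\}=\inf_{Q\in\mathrm{Mart}(\Omega)}\Big(E_Q[c]+\sum_{t=0}^T\mathcal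 D_t(Q_t)\Big),$$ and if $\mathfrak P(c)<+\infty$ then the infimum is attained by some $Q\in\mathrm{Mart}(\Omega)$. -/

import Mathlib

open MeasureTheory ProbabilityTheory Filter Topology
open scoped ENNReal BoundedContinuousFunction

namespace EMOT

/-- The set of possible prices of the `d` stocks at date `t`: the product over `j` of the sets
`K t j`. -/
abbrev Slice {T d : ℕ} (K : Fin (T + 1) → Fin d → Set ℝ) (t : Fin (T + 1)) : Type :=
  (j : Fin d) → K t j

/-- The path space: the product over the dates `0, …, T` of the slices. -/
abbrev Omega {T d : ℕ} (K : Fin (T + 1) → Fin d → Set ℝ) : Type :=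
  (t : Fin (T + 1)) → Slice K t

/-- Path segments `(x_0, …, x_t)`. -/
abbrev History {T d : ℕ} (K : Fin (T + 1) → Fin d → Set ℝ) (t : Fin (T + 1)) : Type :=
  (s : Set.Iic t) → Slice K s

/-- The space `C_t` of continuous functions on the slice at date `t` for which
`sup_x |φ x| / (1 + ∑ j, |x j|)` is finite. -/
def weightedC {T d : ℕ} (K : Fin (T + 1) → Fin d → Set ℝ) (t : Fin (T + 1)) :
    Submodule ℝ (Slice K t → ℝ) where
  carrier := {φ | Continuous φ ∧ ∃ M : ℝ, ∀ x, |φ x| ≤ M * (1 + ∑ j, |(x j : ℝ)|)}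
  zero_mem' := ⟨continuous_const, 0, fun x => by simp⟩
  add_mem' := by
    rintro φ ψ ⟨hφ, M, hM⟩ ⟨hψ, N, hN⟩
    refine ⟨hφ.add hψ, M + N, fun x => ?_⟩
    rw [add_mul]
    exact (abs_add_le _ _).trans (add_le_add (hM x) (hN x))
  smul_mem' := by
    rintro a φ ⟨hφ, M, hM⟩
    refine ⟨hφ.const_smul a, |a| * M, fun x => ?_⟩
    rw [Pi.smul_apply, smul_eq_mul, abs_mul, mul_assoc]
    exact mul_le_mul_of_nonneg_left (hM x) (abs_nonneg a)

/-- Dynamic trading strategies: at every date `t < T` and for every stock `j`, a bounded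
continuous function of the path up to date `t`. -/
abbrev Strategy {T d : ℕ} (K : Fin (T + 1) → Fin d → Set ℝ) : Type :=
  (t : Fin T) → Fin d → (History K t.castSucc →ᵇ ℝ)

/-- The elementary stochastic integral `I^Δ`. -/
def stochInt {T d : ℕ} {K : Fin (T + 1) → Fin d → Set ℝ} (Δ : Strategy K) (x : Omega K) : ℝ :=
  ∑ t : Fin T, ∑ j : Fin d,
    Δ t j (fun s => x s) * ((x t.succ j : ℝ) - (x t.castSucc j : ℝ))

/-- The canonical `d`-dimensional price process. -/
def canon {T d : ℕ} (K : Fin (T + 1) → Fin d → Set ℝ) (t : Fin (T + 1)) (x : Omega K) :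
    Fin d → ℝ :=
  fun j => (x t j : ℝ)

theorem stronglyMeasurable_canon {T d : ℕ} (K : Fin (T + 1) → Fin d → Set ℝ)
    (t : Fin (T + 1)) : StronglyMeasurable (canon K t) := by
  refine Measurable.stronglyMeasurable (measurable_pi_lambda _ fun j => ?_)
  exact measurable_subtype_coe.comp ((measurable_pi_apply j).comp (measurable_pi_apply t))

/-- The natural filtration of the canonical process. -/
noncomputable def canonFiltration {T d : ℕ} (K : Fin (T + 1) → Fin d → Set ℝ) :
    Filtration (Fin (T + 1)) (inferInstance : MeasurableSpace (Omega K)) :=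
  Filtration.natural (canon K) (stronglyMeasurable_canon K)

/-- `Mart(Ω)`: the Borel probability measures on the path space under which every coordinate of
the canonical process is a martingale in its natural filtration. -/
def Mart {T d : ℕ} (K : Fin (T + 1) → Fin d → Set ℝ) : Set (Measure (Omega K)) :=
  {Q | IsProbabilityMeasure Q ∧
    ∀ j : Fin d, Martingale (fun t x => canon K t x j) (canonFiltration K) Q}

/-- The expectation of an extended real function, `∫ c⁺ - ∫ c⁻`; it is meaningful as soon as one
of the two parts is finite. -/
noncomputable def expect {Ω : Type*} [MeasurableSpace Ω] (Q : Measure Ω) (c : Ω → EReal) :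
    EReal :=
  ((∫⁻ x, (c x).toENNReal ∂Q : ℝ≥0∞) : EReal) - ((∫⁻ x, (-c x).toENNReal ∂Q : ℝ≥0∞) : EReal)

/-- The marginal of `Q` at date `t`. -/
noncomputable def marginal {T d : ℕ} {K : Fin (T + 1) → Fin d → Set ℝ} (Q : Measure (Omega K))
    (t : Fin (T + 1)) : Measure (Slice K t) :=
  Q.map (fun x => x t)

/-- The penalization `D_t`, conjugate to `S_t`. -/
noncomputable def penalty {T d : ℕ} {K : Fin (T + 1) → Fin d → Set ℝ} {t : Fin (T + 1)}
    {E : Submodule ℝ (Slice K t → ℝ)} (S : E → ℝ) (μ : Measure (Slice K t)) : EReal :=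
  ⨆ φ : E, ((S φ - ∫ y, (φ : Slice K t → ℝ) y ∂μ : ℝ) : EReal)

/-- Cash additivity of `S` on a space of functions that contains the constants. -/
def CashAdditive {X : Type*} {E : Submodule ℝ (X → ℝ)} (h1 : (1 : X → ℝ) ∈ E) (S : E → ℝ) :
    Prop :=
  ∀ (φ : E) (b : ℝ), S (φ + b • ⟨1, h1⟩) = S φ + b

/-- The functional `U(φ) = ∑ t, S_t(φ_t)`. -/
noncomputable def additiveU {T d : ℕ} {K : Fin (T + 1) → Fin d → Set ℝ}
    {E : (t : Fin (T + 1)) → Submodule ℝ (Slice K t → ℝ)} (S : (t : Fin (T + 1)) → E t → ℝ)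
    (φ : (t : Fin (T + 1)) → E t) : EReal :=
  ((∑ t, S t (φ t) : ℝ) : EReal)

/-- The functional `V(φ) = -U(-φ)`. -/
noncomputable def convexV {T d : ℕ} {K : Fin (T + 1) → Fin d → Set ℝ}
    {E : (t : Fin (T + 1)) → Submodule ℝ (Slice K t → ℝ)}
    (U : ((t : Fin (T + 1)) → E t) → EReal) (φ : (t : Fin (T + 1)) → E t) : EReal :=
  -U (-φ)

/-- The generalized optimized certainty equivalent
`S^U(φ) = sup_{β ∈ ℝ^{T+1}} (U(φ + β) - ∑ t, β_t)`. -/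
noncomputable def oce {T d : ℕ} {K : Fin (T + 1) → Fin d → Set ℝ}
    {E : (t : Fin (T + 1)) → Submodule ℝ (Slice K t → ℝ)}
    (h1 : ∀ t, (1 : Slice K t → ℝ) ∈ E t)
    (U : ((t : Fin (T + 1)) → E t) → EReal) (φ : (t : Fin (T + 1)) → E t) : EReal :=
  ⨆ β : Fin (T + 1) → ℝ, (U (fun t => φ t + β t • ⟨1, h1 t⟩) - ((∑ t, β t : ℝ) : EReal))

/-- The set `Φ_z(c)` of static positions in the domain of `S^U` which, together with `z`,
subhedge `c` on the whole path space. -/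
def subhedges {T d : ℕ} {K : Fin (T + 1) → Fin d → Set ℝ}
    {E : (t : Fin (T + 1)) → Submodule ℝ (Slice K t → ℝ)}
    (h1 : ∀ t, (1 : Slice K t → ℝ) ∈ E t)
    (U : ((t : Fin (T + 1)) → E t) → EReal) (c : Omega K → EReal) (z : Omega K → ℝ) :
    Set ((t : Fin (T + 1)) → E t) :=
  {φ | ⊥ < oce h1 U φ ∧
    ∀ x, ((∑ t, (φ t : Slice K t → ℝ) (x t) + z x : ℝ) : EReal) ≤ c x}

/-- The generalized robust subhedging value of `c`, with `-A` as set of terminal values of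
dynamic positions. -/
noncomputable def primalValue {T d : ℕ} {K : Fin (T + 1) → Fin d → Set ℝ}
    {E : (t : Fin (T + 1)) → Submodule ℝ (Slice K t → ℝ)}
    (h1 : ∀ t, (1 : Slice K t → ℝ) ∈ E t)
    (U : ((t : Fin (T + 1)) → E t) → EReal) (A : Set (Omega K → ℝ)) (c : Omega K → EReal) :
    EReal :=
  ⨆ (z : Omega K → ℝ) (_ : -z ∈ A) (φ : (t : Fin (T + 1)) → E t) (_ : φ ∈ subhedges h1 U c z),
    oce h1 U φ

/-- There are compact sets `C n t` and nonnegative instruments `f n t` such that, for every `n`,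
the sum of the `f n t` dominates `1 + ∑ |x_t^j|` outside the product of the `C n t`, while
`V(Γ f n)` tends to `0` for every `Γ > 0`. -/
def TailControl {T d : ℕ} {K : Fin (T + 1) → Fin d → Set ℝ}
    {E : (t : Fin (T + 1)) → Submodule ℝ (Slice K t → ℝ)}
    (U : ((t : Fin (T + 1)) → E t) → EReal) : Prop :=
  ∃ (C : ℕ → (t : Fin (T + 1)) → Set (Slice K t)) (f : ℕ → (t : Fin (T + 1)) → E t),
    (∀ n t, IsCompact (C n t)) ∧
    (∀ n t y, 0 ≤ (f n t : Slice K t → ℝ) y) ∧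
    (∀ n (x : Omega K), ¬ (∀ t, x t ∈ C n t) →
      1 + ∑ t, ∑ j, |(x t j : ℝ)| ≤ ∑ t, (f n t : Slice K t → ℝ) (x t)) ∧
    ∀ Γ : ℝ, 0 < Γ → Tendsto (fun n => convexV U (fun t => Γ • f n t)) atTop (𝓝 0)

end EMOT

/-! Weak duality is integration. Gains from trading have mean zero under a martingale measure, so a
subhedge gives `∑ ∫ φ_t dQ_t ≤ E_Q[c]`, and `S_t(φ_t)` exceeds `∫ φ_t dQ_t` by at most the penalty
(`weak_duality`). Cash additivity makes `S^U` equal to `U`, so the two primal values coincide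
(`primalValue_additiveU`).

For the converse, let the primal value be a real number `m` and perturb the claim: the pairs `(h,
u)` such that `c + h` can be subhedged with value at least `u` form a convex set, with `u ≤ m` over
`h = 0`. Hahn-Banach gives a linear `L` on the continuous functions of growth `1 + ∑ |x_t^j|` with
`u ≤ m + L h` on that set (`exists_supporting_functional`). Adding gains, cash or nonnegative
functions to `h` changes `u` in a known way, which forces `L` to be positive, normalized and zero on
gains (`exists_pricing_functional`).

The path space need not be compact, so `L` could lose mass at infinity. The tail instruments exclude
this: `V(Γ f^n) → 0` for every `Γ` forces `L(f^n) → 0`, which is the tightness under which the Riesz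
theorem represents `L` by a measure `Q` (`exists_measure_eq_of_tight`). Vanishing on gains makes `Q`
a martingale measure. What remains of the supporting inequality is `∑ S_t(φ_t) ≤ m + ∑ ∫ φ_t dQ_t -
∫ g dQ` for continuous `g ≤ c`. The supremum over `g` produces `E_Q[c]`, by lower semicontinuity
(`expect_le_of_forall_integral_le`), and the supremum over each `φ_t` separately produces the
penalties (`sum_iSup_coe_le`). So `Q` has dual value at most `m`, hence is optimal. -/

namespace EMOT

/-! ### A supporting functional of a convex hypograph -/

/-- Algebraic Hahn-Banach theorem for a convex relation `R` whose values at `0` are at most `m`: it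
has a supporting linear functional at `0`. -/
theorem exists_supporting_functional {B : Type*} [AddCommGroup B] [Module ℝ B]
    {R : Set (B × ℝ)} (hR : Convex ℝ R) {m : ℝ} (hm : ∀ u, ((0 : B), u) ∈ R → u ≤ m)
    (hne : ∀ h, ∃ u, (h, u) ∈ R) :
    ∃ L : B →ₗ[ℝ] ℝ, ∀ h u, (h, u) ∈ R → u ≤ m + L h := by
  -- With `p h = m - sup {u | (-h, u) ∈ R}`, which is convex, `N h` is the infimum of `p (t • h) /
  -- t` over `t > 0`: the largest positively homogeneous function below `p`. A linear functional
  -- below `N` is the required one.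
  let A : B → Set ℝ := fun h => {r | ∃ t > 0, ∃ u, (-(t • h), u) ∈ R ∧ r = (m - u) / t}
  let N : B → ℝ := fun h => sInf (A h)
  have hA_ne : ∀ h, (A h).Nonempty := fun h => by
    obtain ⟨u, hu⟩ := hne (-((1 : ℝ) • h))
    exact ⟨_, 1, one_pos, u, hu, rfl⟩
  have hA_bdd : ∀ h, BddBelow (A h) := fun h => by
    obtain ⟨v, hv⟩ := hne h
    refine ⟨v - m, ?_⟩
    rintro r ⟨t, ht, u, hu, rfl⟩
    -- The weights are those at which the segment from `-(t • h)` to `h` crosses `0`, where `hm`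
    -- applies.
    have h0 := hR hu hv (a := 1 / (1 + t)) (b := t / (1 + t)) (by positivity) (by positivity)
      (by field_simp)
    have h1 : ((1 / (1 + t)) • (-(t • h), u) + (t / (1 + t)) • (h, v) : B × ℝ)
        = (0, (u + t * v) / (1 + t)) := by
      ext
      · simp only [Prod.fst_add, Prod.smul_fst, smul_neg, smul_smul]
        rw [one_div_mul_eq_div, neg_add_cancel]
      · simp only [Prod.snd_add, Prod.smul_snd, smul_eq_mul]
        ring
    rw [h1] at h0
    have h2 := hm _ h0
    rw [div_le_iff₀ (by positivity)] at h2
    rw [le_div_iff₀ ht]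
    linarith
  have hN_le : ∀ h t u, 0 < t → (-(t • h), u) ∈ R → N h ≤ (m - u) / t := fun h t u ht hu =>
    csInf_le (hA_bdd h) ⟨t, ht, u, hu, rfl⟩
  have hN_smul_le : ∀ c : ℝ, 0 < c → ∀ x, N (c • x) ≤ c * N x := fun c hc x => by
    rw [← div_le_iff₀' hc]
    refine le_csInf (hA_ne x) ?_
    rintro r ⟨t, ht, u, hu, rfl⟩
    have := hN_le (c • x) (t / c) u (by positivity)
      (by rwa [smul_smul, div_mul_cancel₀ _ hc.ne'])
    rw [div_le_iff₀ hc]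
    calc _ ≤ _ := this
      _ = _ := by field_simp
  have hN_smul : ∀ c : ℝ, 0 < c → ∀ x, N (c • x) = c * N x := fun c hc x => by
    refine le_antisymm (hN_smul_le c hc x) ?_
    have := hN_smul_le c⁻¹ (inv_pos.2 hc) (c • x)
    rw [smul_smul, inv_mul_cancel₀ hc.ne', one_smul] at this
    rwa [← le_inv_mul_iff₀ hc]
  have hN_add : ∀ x y, N (x + y) ≤ N x + N y := fun x y => by
    rw [← sub_le_iff_le_add']
    refine le_csInf (hA_ne y) ?_
    rintro r ⟨s, hs, v, hv, rfl⟩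
    rw [sub_le_comm]
    refine le_csInf (hA_ne x) ?_
    rintro r ⟨t, ht, u, hu, rfl⟩
    -- These weights give `x` and `y` the same coefficient `s * t / (s + t)`.
    have h0 := hR hu hv (a := s / (s + t)) (b := t / (s + t)) (by positivity) (by positivity)
      (by field_simp)
    have h1 : ((s / (s + t)) • (-(t • x), u) + (t / (s + t)) • (-(s • y), v) : B × ℝ)
        = (-((s * t / (s + t)) • (x + y)), (s * u + t * v) / (s + t)) := by
      ext
      · simp only [Prod.fst_add, Prod.smul_fst, smul_neg, smul_smul, smul_add, neg_add]
        congr 3 <;> ring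
      · simp only [Prod.snd_add, Prod.smul_snd, smul_eq_mul]
        ring
    rw [h1] at h0
    have h2 := hN_le (x + y) _ _ (by positivity) h0
    have h3 : (m - (s * u + t * v) / (s + t)) / (s * t / (s + t))
        = (m - u) / t + (m - v) / s := by
      field_simp
      ring
    rw [h3] at h2
    linarith
  -- The functional extended is the zero one on the trivial subspace, so only `0 ≤ N 0` has to be
  -- checked.
  obtain ⟨g, -, hg⟩ := exists_extension_of_le_sublinear (⊥ : B →ₗ.[ℝ] ℝ) N hN_smul hN_add (by
    rintro ⟨x, hx⟩
    obtain rfl : x = 0 := (Submodule.mem_bot ℝ).1 hx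
    have h0 : (⊥ : B →ₗ.[ℝ] ℝ) ⟨0, hx⟩ = 0 := LinearPMap.map_zero _
    rw [h0]
    refine le_csInf (hA_ne 0) ?_
    rintro r ⟨t, ht, u, hu, rfl⟩
    rw [smul_zero, neg_zero] at hu
    exact div_nonneg (sub_nonneg.2 (hm u hu)) ht.le)
  refine ⟨g, fun h u hu => ?_⟩
  have h1 := (hg (-h)).trans (hN_le (-h) 1 u one_pos (by simpa using hu))
  rw [map_neg, div_one] at h1
  linarith

/-- An affine function of `t ≥ 0` that is bounded below has a nonnegative slope. -/
theorem nonneg_of_forall_le_add_mul {a b u : ℝ} (h : ∀ t : ℝ, 0 ≤ t → u ≤ b + t * a) : 0 ≤ a := by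
  by_contra! ha
  have h0 := h ((|b - u| + 1) / (-a)) (div_nonneg (by positivity) (by linarith))
  have h1 : (|b - u| + 1) / (-a) * a = -(|b - u| + 1) := by
    rw [div_neg, neg_mul, div_mul_cancel₀ _ ha.ne]
  rw [h1] at h0
  linarith [le_abs_self (b - u)]

/-! ### Representation of positive functionals on functions of bounded growth -/

/-- The continuous functions that are bounded by a multiple of `w`. -/
def growthSpace {X : Type*} [TopologicalSpace X] (w : X → ℝ) : Submodule ℝ (X → ℝ) where
  carrier := {g | Continuous g ∧ ∃ M : ℝ, ∀ x, |g x| ≤ M * w x}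
  zero_mem' := ⟨continuous_const, 0, fun x => by simp⟩
  add_mem' := by
    rintro φ ψ ⟨hφ, M, hM⟩ ⟨hψ, N, hN⟩
    refine ⟨hφ.add hψ, M + N, fun x => ?_⟩
    rw [add_mul]
    exact (abs_add_le _ _).trans (add_le_add (hM x) (hN x))
  smul_mem' := by
    rintro a φ ⟨hφ, M, hM⟩
    refine ⟨hφ.const_smul a, |a| * M, fun x => ?_⟩
    rw [Pi.smul_apply, smul_eq_mul, abs_mul, mul_assoc]
    exact mul_le_mul_of_nonneg_left (hM x) (abs_nonneg a)

section Representation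

open CompactlySupported

variable {X : Type*} [TopologicalSpace X] {w : X → ℝ}

/-- The inclusion of the compactly supported continuous functions. -/
def growthSpace.ofCompactSupport (hw1 : ∀ x, 1 ≤ w x) : C_c(X, ℝ) →ₗ[ℝ] growthSpace w where
  toFun f := ⟨f, f.continuous, by
    obtain ⟨C, hC⟩ := f.hasCompactSupport.exists_bound_of_continuous f.continuous
    refine ⟨C, fun x => (hC x).trans ?_⟩
    have : 0 ≤ C := (norm_nonneg _).trans (hC x)
    nlinarith [hw1 x]⟩
  map_add' f g := rfl
  map_smul' a f := rfl

/-- A continuous cutoff function for the sublevel sets of `w`. -/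
noncomputable def cutoff {X : Type*} (w : X → ℝ) (r : ℝ) (x : X) : ℝ := max 0 (min 1 (r + 1 - w x))

theorem cutoff_nonneg {X : Type*} {w : X → ℝ} (r : ℝ) (x : X) : 0 ≤ cutoff w r x := le_max_left _ _

theorem cutoff_le_one {X : Type*} {w : X → ℝ} (r : ℝ) (x : X) : cutoff w r x ≤ 1 :=
  max_le zero_le_one (min_le_left _ _)

theorem cutoff_eq_one {X : Type*} {w : X → ℝ} {r : ℝ} {x : X} (h : w x ≤ r) : cutoff w r x = 1 := by
  rw [cutoff, min_eq_left (by linarith), max_eq_right zero_le_one]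

theorem cutoff_eq_zero {X : Type*} {w : X → ℝ} {r : ℝ} {x : X} (h : r + 1 ≤ w x) : cutoff w r x = 0 := by
  rw [cutoff, max_eq_left (min_le_of_right_le (by linarith))]

theorem continuous_cutoff (hw : Continuous w) (r : ℝ) : Continuous (cutoff w r) := by
  unfold cutoff
  fun_prop

/-- The product of a continuous function with a cutoff function. -/
noncomputable def cutoffMul [T2Space X] (hw : Continuous w) (hwc : ∀ r, IsCompact {x | w x ≤ r}) (r : ℝ)
    {g : X → ℝ} (hg : Continuous g) : C_c(X, ℝ) where
  toFun x := cutoff w r x * g x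
  continuous_toFun := (continuous_cutoff hw r).mul hg
  hasCompactSupport' := by
    refine HasCompactSupport.of_support_subset_isCompact (hwc (r + 1)) fun x hx => ?_
    by_contra h
    refine hx ?_
    rw [Set.mem_ofPred_eq, not_le] at h
    simp [cutoff_eq_zero h.le]

/-- A positive functional on functions of growth `w` that is tight, in the sense that `w` is
dominated outside of compact sets by functions at which the functional is arbitrarily small,
is represented by a measure. -/
theorem exists_measure_eq_of_tight [T2Space X] [LocallyCompactSpace X] [MeasurableSpace X]
    [BorelSpace X] (hw : Continuous w) (hw1 : ∀ x, 1 ≤ w x)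
    (hwc : ∀ r, IsCompact {x | w x ≤ r}) (L : growthSpace w →ₗ[ℝ] ℝ)
    (hL : ∀ g : growthSpace w, (∀ x, 0 ≤ (g : X → ℝ) x) → 0 ≤ L g)
    (F : ℕ → growthSpace w) (r : ℕ → ℝ) (hF0 : ∀ n x, 0 ≤ (F n : X → ℝ) x)
    (hF : ∀ n x, r n < w x → w x ≤ (F n : X → ℝ) x)
    (hlim : Tendsto (fun n => L (F n)) atTop (𝓝 0)) :
    ∃ Q : Measure X, ∀ g : growthSpace w,
      Integrable (g : X → ℝ) Q ∧ ∫ x, (g : X → ℝ) x ∂Q = L g := by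
  have hw0 : ∀ x, 0 ≤ w x := fun x => zero_le_one.trans (hw1 x)
  have hmono : ∀ g h : growthSpace w, (∀ x, (g : X → ℝ) x ≤ (h : X → ℝ) x) → L g ≤ L h :=
    fun g h hgh => by
      have := hL (h - g) fun x => sub_nonneg.2 (hgh x)
      rwa [map_sub, sub_nonneg] at this
  let Λ : C_c(X, ℝ) →ₚ[ℝ] ℝ :=
    PositiveLinearMap.mk₀ (L ∘ₗ growthSpace.ofCompactSupport hw1) fun f hf => hL _ hf
  let Q := RealRMK.rieszMeasure Λ
  have hQ : ∀ f : C_c(X, ℝ), ∫ x, f x ∂Q = L (growthSpace.ofCompactSupport hw1 f) :=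
    RealRMK.integral_rieszMeasure Λ
  -- The level is at least `n`, so the cutoffs tend to `1` pointwise, and at least `r n`, so `F n`
  -- dominates `w` wherever the cutoff differs from `1`.
  let ρ : ℕ → ℝ := fun n => max (r n) n
  have hρ : ∀ x, ∀ᶠ n in atTop, cutoff w (ρ n) x = 1 := fun x => by
    obtain ⟨k, hk⟩ := exists_nat_ge (w x)
    filter_upwards [eventually_ge_atTop k] with n hn
    exact cutoff_eq_one (hk.trans ((Nat.cast_le.2 hn).trans (le_max_right _ _)))
  let ww : growthSpace w := ⟨w, hw, 1, fun x => by rw [one_mul, abs_of_nonneg (hw0 x)]⟩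
  have hcut : ∀ (n : ℕ) (g : growthSpace w),
      ∫ x, cutoff w (ρ n) x * (g : X → ℝ) x ∂Q
        = L (growthSpace.ofCompactSupport hw1 (cutoffMul hw hwc (ρ n) g.2.1)) :=
    fun n g => hQ (cutoffMul hw hwc (ρ n) g.2.1)
  have hcut_int : ∀ n, Integrable (fun x => cutoff w (ρ n) x * w x) Q := fun n =>
    (cutoffMul hw hwc (ρ n) hw).continuous.integrable_of_hasCompactSupport
      (cutoffMul hw hwc (ρ n) hw).hasCompactSupport
  -- Fatou's lemma: the truncations of `w` have integrals at most `L w`.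
  have hint : Integrable w Q := by
    refine ⟨hw.measurable.aestronglyMeasurable, ?_⟩
    have h1 : ∀ x, Tendsto (fun n => ENNReal.ofReal (cutoff w (ρ n) x * w x)) atTop (𝓝 ‖w x‖ₑ) :=
      fun x => by
        refine tendsto_const_nhds.congr' ?_
        filter_upwards [hρ x] with n hn
        rw [hn, one_mul, Real.enorm_eq_ofReal (hw0 x)]
    calc ∫⁻ x, ‖w x‖ₑ ∂Q
        = ∫⁻ x, liminf (fun n => ENNReal.ofReal (cutoff w (ρ n) x * w x)) atTop ∂Q :=
          lintegral_congr fun x => (h1 x).liminf_eq.symm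
      _ ≤ liminf (fun n => ∫⁻ x, ENNReal.ofReal (cutoff w (ρ n) x * w x) ∂Q) atTop :=
          lintegral_liminf_le fun n =>
            ((continuous_cutoff hw _).mul hw).measurable.ennreal_ofReal
      _ ≤ ENNReal.ofReal (L ww) := by
          refine liminf_le_of_le (by isBoundedDefault) fun b hb => ?_
          obtain ⟨n, hn⟩ := hb.exists
          refine hn.trans ?_
          rw [← ofReal_integral_eq_lintegral_ofReal (hcut_int n)
            (ae_of_all _ fun x => mul_nonneg (cutoff_nonneg _ _) (hw0 x))]
          refine ENNReal.ofReal_le_ofReal ?_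
          rw [hcut n ww]
          exact hmono _ _ fun x => mul_le_of_le_one_left (hw0 x) (cutoff_le_one _ _)
      _ < ⊤ := ENNReal.ofReal_lt_top
  refine ⟨Q, fun g => ?_⟩
  obtain ⟨hgc, M, hM⟩ := g.2
  have hg_int : Integrable (g : X → ℝ) Q :=
    (hint.const_mul M).mono' hgc.measurable.aestronglyMeasurable (ae_of_all _ hM)
  refine ⟨hg_int, ?_⟩
  have hlim1 : Tendsto (fun n => ∫ x, cutoff w (ρ n) x * (g : X → ℝ) x ∂Q) atTop
      (𝓝 (∫ x, (g : X → ℝ) x ∂Q)) := by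
    refine tendsto_integral_of_dominated_convergence (fun x => M * w x)
      (fun n => ((continuous_cutoff hw _).mul hgc).measurable.aestronglyMeasurable)
      (hint.const_mul M) (fun n => ae_of_all _ fun x => ?_) (ae_of_all _ fun x => ?_)
    · rw [norm_mul, Real.norm_of_nonneg (cutoff_nonneg _ _)]
      exact (mul_le_of_le_one_left (norm_nonneg _) (cutoff_le_one _ _)).trans (hM x)
    · refine tendsto_const_nhds.congr' ?_
      filter_upwards [hρ x] with n hn
      rw [hn, one_mul]
  -- The truncation error of `g` lives above the level `ρ n`, so `L` of it is at most `M * L (F n)`.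
  -- This makes `L g` the limit of the truncated integrals, whose other limit is `∫ g` by dominated
  -- convergence.
  have hdom : ∀ n x, |cutoff w (ρ n) x * (g : X → ℝ) x - (g : X → ℝ) x|
      ≤ M * (F n : X → ℝ) x := fun n x => by
    have hM0 : 0 ≤ M := by
      by_contra! h
      nlinarith [hM x, abs_nonneg ((g : X → ℝ) x), hw1 x]
    rcases le_or_gt (w x) (ρ n) with h | h
    · rw [cutoff_eq_one h, one_mul, sub_self, abs_zero]
      exact mul_nonneg hM0 (hF0 n x)
    · have h1 : cutoff w (ρ n) x * (g : X → ℝ) x - (g : X → ℝ) x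
          = -((1 - cutoff w (ρ n) x) * (g : X → ℝ) x) := by ring
      rw [h1, abs_neg, abs_mul, abs_of_nonneg (sub_nonneg.2 (cutoff_le_one _ _))]
      calc _ ≤ |(g : X → ℝ) x| :=
            mul_le_of_le_one_left (abs_nonneg _) (sub_le_self _ (cutoff_nonneg _ _))
        _ ≤ M * w x := hM x
        _ ≤ _ := mul_le_mul_of_nonneg_left (hF n x ((le_max_left _ _).trans_lt h)) hM0
  have hlim2 : Tendsto (fun n => ∫ x, cutoff w (ρ n) x * (g : X → ℝ) x ∂Q) atTop (𝓝 (L g)) := by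
    rw [tendsto_iff_norm_sub_tendsto_zero]
    refine squeeze_zero (fun n => norm_nonneg _) (fun n => ?_)
      (by simpa using hlim.const_mul M)
    rw [hcut n g, ← map_sub, Real.norm_eq_abs, abs_le', ← map_neg, ← smul_eq_mul, ← map_smul]
    exact ⟨hmono _ _ fun x => (le_abs_self _).trans (hdom n x),
      hmono _ _ fun x => (neg_le_abs _).trans (hdom n x)⟩
  exact tendsto_nhds_unique hlim1 hlim2

end Representation

/-! ### Approximation of lower semicontinuous functions from below -/

section InfConvolution

variable {X : Type*} [PseudoEMetricSpace X]

/-- The largest `k`-Lipschitz function below `u ∧ k`. -/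
noncomputable def infConv (u : X → ℝ≥0∞) (k : ℕ) (x : X) : ℝ≥0∞ :=
  ⨅ y, (min (u y) k + k * edist x y)

theorem infConv_le_min (u : X → ℝ≥0∞) (k : ℕ) (x : X) : infConv u k x ≤ min (u x) k :=
  (iInf_le _ x).trans (by simp)

theorem infConv_ne_top (u : X → ℝ≥0∞) (k : ℕ) (x : X) : infConv u k x ≠ ⊤ :=
  ((infConv_le_min u k x).trans_lt ((min_le_right _ _).trans_lt (ENNReal.natCast_lt_top k))).ne

theorem continuous_infConv (u : X → ℝ≥0∞) (k : ℕ) : Continuous (infConv u k) := by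
  refine continuous_of_le_add_edist k (ENNReal.natCast_ne_top k) fun x y => ?_
  rw [infConv, infConv, ENNReal.iInf_add]
  refine le_iInf fun z => (iInf_le _ z).trans ?_
  rw [add_assoc, ← mul_add, add_comm (edist y z)]
  gcongr
  exact edist_triangle _ _ _

theorem continuous_toReal_infConv (u : X → ℝ≥0∞) (k : ℕ) :
    Continuous fun x => (infConv u k x).toReal :=
  ENNReal.continuousOn_toReal.comp_continuous (continuous_infConv u k) (infConv_ne_top u k)

theorem monotone_infConv (u : X → ℝ≥0∞) (x : X) : Monotone fun k => infConv u k x :=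
  fun k l hkl => iInf_mono fun y => by gcongr

theorem iSup_infConv {u : X → ℝ≥0∞} (hu : LowerSemicontinuous u) (x : X) :
    ⨆ k, infConv u k x = u x := by
  refine le_antisymm (iSup_le fun k => (infConv_le_min u k x).trans (min_le_left _ _)) ?_
  refine le_of_forall_lt fun a ha => ?_
  obtain ⟨b, hab, hb⟩ := exists_between ha
  obtain ⟨δ, hδ, hball⟩ := EMetric.mem_nhds_iff.1 (hu x b hb)
  have hb_top : b ≠ ⊤ := hb.ne_top
  -- The factor `δ` makes the distance penalty exceed `b` outside the ball; the factor `1` makes the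
  -- truncation level `k` exceed `b` inside it.
  obtain ⟨k, hk⟩ := ENNReal.exists_nat_mul_gt (a := min δ 1) (b := b) (by simp [hδ.ne']) hb_top
  refine hab.trans_le (le_trans ?_ (le_iSup _ k))
  refine le_iInf fun y => ?_
  rcases lt_or_ge (edist y x) δ with h | h
  · refine le_add_right (le_min (hball h).le (hk.le.trans ?_))
    exact mul_le_of_le_one_right' (min_le_right _ _)
  · refine le_add_left (hk.le.trans ?_)
    rw [edist_comm]
    gcongr
    exact (min_le_left _ _).trans h

end InfConvolution

/-! ### Expectations of extended real functions -/

section Expect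

variable {Ω : Type*} [MeasurableSpace Ω] {Q : Measure Ω} {c : Ω → EReal}

theorem coe_toReal_toEReal {a : ℝ≥0∞} (ha : a ≠ ⊤) : ((a.toReal : ℝ) : EReal) = (a : EReal) :=
  by rw [← EReal.toReal_coe_ennreal, EReal.coe_toReal (by simpa) (by simp)]

theorem coe_integral_eq_expect {h : Ω → ℝ} (hh : Integrable h Q) :
    ((∫ x, h x ∂Q : ℝ) : EReal) = expect Q (fun x => (h x : EReal)) := by
  have h1 := hh.lintegral_lt_top.ne
  have h2 := hh.neg.lintegral_lt_top.ne
  rw [integral_eq_lintegral_pos_part_sub_lintegral_neg_part hh, EReal.coe_sub]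
  simp only [Pi.neg_apply] at h2
  rw [coe_toReal_toEReal h1, coe_toReal_toEReal h2]
  rfl

/-- The positive part grows and the negative part shrinks; no integrability is needed, since
subtraction in `EReal` is monotone even where `⊤ - ⊤` occurs. -/
theorem expect_mono {c' : Ω → EReal} (hc : ∀ x, c x ≤ c' x) : expect Q c ≤ expect Q c' := by
  refine EReal.sub_le_sub ?_ ?_
  · exact EReal.coe_ennreal_le_coe_ennreal_iff.2
      (lintegral_mono fun x => EReal.toENNReal_le_toENNReal (hc x))
  · exact EReal.coe_ennreal_le_coe_ennreal_iff.2
      (lintegral_mono fun x => EReal.toENNReal_le_toENNReal (EReal.neg_le_neg_iff.2 (hc x)))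

theorem integral_le_expect {h : Ω → ℝ} (hh : Integrable h Q) (hc : ∀ x, (h x : EReal) ≤ c x) :
    ((∫ x, h x ∂Q : ℝ) : EReal) ≤ expect Q c :=
  (coe_integral_eq_expect hh).trans_le (expect_mono hc)

/-- A function bounded below by `-a` has expectation at most `v` if this holds after adding `a`. -/
theorem expect_le_of_lintegral_add_le {a : Ω → ℝ} (ha : Integrable a Q) (ha0 : ∀ x, 0 ≤ a x)
    (hcm : Measurable c) (hac : ∀ x, ((-a x : ℝ) : EReal) ≤ c x) {v : ℝ}
    (hv : 0 ≤ ∫ x, a x ∂Q + v)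
    (h : ∫⁻ x, (c x + a x).toENNReal ∂Q ≤ ENNReal.ofReal (∫ x, a x ∂Q + v)) :
    expect Q c ≤ v := by
  -- As `c + a ≥ 0`, this is `c⁺ + a = (c + a)⁺ + c⁻`, written with sums only so that it remains
  -- valid where `c = ⊤`.
  have hpt : ∀ x, (c x).toENNReal + ENNReal.ofReal (a x)
      = (c x + a x).toENNReal + (-c x).toENNReal := fun x => by
    have hx := hac x
    have h0 := ha0 x
    induction hcx : c x with
    | bot => rw [hcx] at hx; simp at hx
    | top => simp
    | coe y =>
      rw [hcx, EReal.coe_le_coe_iff] at hx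
      rw [← EReal.coe_add, ← EReal.coe_neg]
      simp only [EReal.real_coe_toENNReal]
      rcases le_total 0 y with hy | hy
      · rw [ENNReal.ofReal_of_nonpos (neg_nonpos.2 hy), add_zero, ENNReal.ofReal_add hy h0]
      · rw [ENNReal.ofReal_of_nonpos hy, zero_add, ← ENNReal.ofReal_add (by linarith) (by linarith)]
        ring_nf
  have hneg : ∀ x, (-c x).toENNReal ≤ ENNReal.ofReal (a x) := fun x => by
    refine EReal.toENNReal_le_toENNReal (y := (a x : EReal)) ?_
    rw [EReal.neg_le, ← EReal.coe_neg]
    exact hac x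
  have ham : AEMeasurable (fun x => ENNReal.ofReal (a x)) Q := ha.aemeasurable.ennreal_ofReal
  have hα : ∫⁻ x, ENNReal.ofReal (a x) ∂Q = ENNReal.ofReal (∫ x, a x ∂Q) :=
    (ofReal_integral_eq_lintegral_ofReal ha (ae_of_all _ ha0)).symm
  have hsum : ∫⁻ x, (c x).toENNReal ∂Q + ∫⁻ x, ENNReal.ofReal (a x) ∂Q
      = ∫⁻ x, (c x + a x).toENNReal ∂Q + ∫⁻ x, (-c x).toENNReal ∂Q := by
    have hnm : Measurable fun x => (-c x).toENNReal := hcm.neg.ereal_toENNReal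
    rw [← lintegral_add_right' _ ham, ← lintegral_add_right _ hnm]
    exact lintegral_congr hpt
  have hN : ∫⁻ x, (-c x).toENNReal ∂Q ≠ ⊤ :=
    ((lintegral_mono hneg).trans_lt (hα ▸ ENNReal.ofReal_lt_top)).ne
  have hU : ∫⁻ x, (c x + a x).toENNReal ∂Q ≠ ⊤ := (h.trans_lt ENNReal.ofReal_lt_top).ne
  have hP : ∫⁻ x, (c x).toENNReal ∂Q ≠ ⊤ := fun hP => by
    rw [hP, top_add] at hsum
    exact ENNReal.add_ne_top.2 ⟨hU, hN⟩ hsum.symm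
  have hsum' := congrArg ENNReal.toReal hsum
  rw [ENNReal.toReal_add hP (hα ▸ ENNReal.ofReal_ne_top), ENNReal.toReal_add hU hN, hα,
    ENNReal.toReal_ofReal (integral_nonneg ha0)] at hsum'
  have hU' := ENNReal.toReal_mono ENNReal.ofReal_ne_top h
  rw [ENNReal.toReal_ofReal hv] at hU'
  rw [expect, ← coe_toReal_toEReal hP, ← coe_toReal_toEReal hN, ← EReal.coe_sub,
    EReal.coe_le_coe_iff]
  linarith

end Expect

/-- The expectation of a lower semicontinuous function is bounded by `v` as soon as this holds for
the functions of growth `w` below it. -/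
theorem expect_le_of_forall_integral_le {X : Type*} [PseudoEMetricSpace X] [MeasurableSpace X]
    [BorelSpace X] {w : X → ℝ} (hw : Continuous w) (hw1 : ∀ x, 1 ≤ w x) {Q : Measure X}
    (hwQ : Integrable w Q) {c : X → EReal} (hc : LowerSemicontinuous c) {A : ℝ} (hA : 0 ≤ A)
    (hlow : ∀ x, ((-(A * w x) : ℝ) : EReal) ≤ c x) {v : ℝ}
    (hv : ∀ g : growthSpace w, (∀ x, ((g : X → ℝ) x : EReal) ≤ c x) →
      ∫ x, (g : X → ℝ) x ∂Q ≤ v) :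
    expect Q c ≤ v := by
  have hw0 : ∀ x, 0 ≤ w x := fun x => zero_le_one.trans (hw1 x)
  -- The shift by `A * w` makes the function nonnegative, so passing to `ℝ≥0∞` loses nothing. Its
  -- Lipschitz regularizations, shifted back, have growth `w`, lie below `c`, and are admissible in
  -- `hv`; monotone convergence concludes.
  let u : X → ℝ≥0∞ := fun x => (c x + ((A * w x : ℝ) : EReal)).toENNReal
  have hu : LowerSemicontinuous u := by
    refine EReal.continuous_toENNReal.comp_lowerSemicontinuous ?_
      (fun _ _ h => EReal.toENNReal_le_toENNReal h)
    refine hc.add' ?_ fun x => ?_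
    · exact (continuous_coe_real_ereal.comp (hw.const_mul A)).lowerSemicontinuous
    · exact EReal.continuousAt_add (Or.inr (EReal.coe_ne_bot _)) (Or.inr (EReal.coe_ne_top _))
  have hcoe : ∀ k x, (((infConv u k x).toReal - A * w x : ℝ) : EReal) ≤ c x := fun k x => by
    have h1 : (infConv u k x : EReal) ≤ c x + ((A * w x : ℝ) : EReal) := by
      rw [← EReal.coe_toENNReal (x := c x + ((A * w x : ℝ) : EReal))]
      · exact EReal.coe_ennreal_le_coe_ennreal_iff.2
          ((infConv_le_min u k x).trans (min_le_left _ _))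
      · have := add_le_add_left (hlow x) ((A * w x : ℝ) : EReal)
        rw [← EReal.coe_add, neg_add_cancel] at this
        exact this
    rw [← coe_toReal_toEReal (infConv_ne_top u k x)] at h1
    rw [EReal.coe_sub]
    exact EReal.sub_le_of_le_add h1
  have hk : ∀ k x, (infConv u k x).toReal ≤ k := fun k x => by
    have := ENNReal.toReal_mono (ENNReal.natCast_ne_top k)
      ((infConv_le_min u k x).trans (min_le_right _ _))
    simpa using this
  have hk_int : ∀ k, Integrable (fun x => (infConv u k x).toReal) Q := fun k => by
    refine (hwQ.const_mul k).mono'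
      (continuous_toReal_infConv u k).measurable.aestronglyMeasurable (ae_of_all _ fun x => ?_)
    rw [Real.norm_of_nonneg ENNReal.toReal_nonneg]
    exact (hk k x).trans (le_mul_of_one_le_right (Nat.cast_nonneg k) (hw1 x))
  have hbound : ∀ k : ℕ, ∫ x, (infConv u k x).toReal ∂Q ≤ ∫ x, A * w x ∂Q + v := fun k => by
    have h1 := hv ⟨fun x => (infConv u k x).toReal - A * w x,
      (continuous_toReal_infConv u k).sub (hw.const_mul A), k + A, fun x => by
        refine (abs_sub _ _).trans ?_
        rw [abs_of_nonneg ENNReal.toReal_nonneg, abs_of_nonneg (mul_nonneg hA (hw0 x)), add_mul]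
        gcongr
        exact (hk k x).trans (le_mul_of_one_le_right (Nat.cast_nonneg k) (hw1 x))⟩ (hcoe k)
    rw [integral_sub (hk_int k) (hwQ.const_mul A)] at h1
    linarith
  refine expect_le_of_lintegral_add_le (hwQ.const_mul A) (fun x => mul_nonneg hA (hw0 x))
    hc.measurable hlow ((integral_nonneg fun x => ENNReal.toReal_nonneg).trans (hbound 0)) ?_
  calc ∫⁻ x, u x ∂Q = ∫⁻ x, ⨆ k, infConv u k x ∂Q :=
        lintegral_congr fun x => (iSup_infConv hu x).symm
    _ = ⨆ k, ∫⁻ x, infConv u k x ∂Q :=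
        lintegral_iSup (fun k => (continuous_infConv u k).measurable)
          fun k l hkl x => monotone_infConv u x hkl
    _ ≤ _ := iSup_le fun k => by
        rw [← lintegral_congr fun x => ENNReal.ofReal_toReal (infConv_ne_top u k x),
          ← ofReal_integral_eq_lintegral_ofReal (hk_int k)
            (ae_of_all _ fun x => ENNReal.toReal_nonneg)]
        exact ENNReal.ofReal_le_ofReal (hbound k)

section

/-! ### Martingale measures and strategies -/

/-- If `ξ` is orthogonal to the bounded continuous functions of `ρ` then its integrals over the
events generated by `ρ` vanish. -/
theorem setIntegral_preimage_eq_zero {Ω H : Type*} [MeasurableSpace Ω] [TopologicalSpace H]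
    [MeasurableSpace H] [BorelSpace H] [HasOuterApproxClosed H] {Q : Measure Ω} {ρ : Ω → H}
    (hρ : Measurable ρ) {ξ : Ω → ℝ} (hξm : Measurable ξ) (hξ : Integrable ξ Q)
    (h : ∀ f : H →ᵇ ℝ, ∫ x, f (ρ x) * ξ x ∂Q = 0) {B : Set H} (hB : MeasurableSet B) :
    ∫ x in ρ ⁻¹' B, ξ x ∂Q = 0 := by
  -- Since `ENNReal.ofReal` truncates at `0`, `μ ξ` and `μ (-ξ)` are the images under `ρ` of `ξ⁺ Q`
  -- and `ξ⁻ Q`. The hypothesis says that these finite measures agree on bounded continuous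
  -- functions, so they are equal.
  let μ : (Ω → ℝ) → Measure H := fun a => (Q.withDensity fun x => ENNReal.ofReal (a x)).map ρ
  have hfin : ∀ a : Ω → ℝ, Integrable a Q → IsFiniteMeasure (μ a) := fun a ha => by
    have := isFiniteMeasure_withDensity_ofReal ha.2
    exact Measure.isFiniteMeasure_map _ _
  have hint : ∀ a : Ω → ℝ, Measurable a → ∀ f : H →ᵇ ℝ,
      ∫ y, f y ∂(μ a) = ∫ x, max (a x) 0 * f (ρ x) ∂Q := fun a ha f => by
    rw [integral_map hρ.aemeasurable f.continuous.measurable.aestronglyMeasurable,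
      integral_withDensity_eq_integral_toReal_smul ha.ennreal_ofReal
        (ae_of_all _ fun _ => ENNReal.ofReal_lt_top)]
    simp only [ENNReal.toReal_ofReal', smul_eq_mul]
  have hmul : ∀ a : Ω → ℝ, Measurable a → Integrable a Q → ∀ f : H →ᵇ ℝ,
      Integrable (fun x => max (a x) 0 * f (ρ x)) Q := fun a ham ha f => by
    refine ha.pos_part.mul_bdd (c := ‖f‖)
      (f.continuous.measurable.comp hρ).aestronglyMeasurable (ae_of_all _ fun x => ?_)
    exact f.norm_coe_le_norm _
  have heq : μ ξ = μ (-ξ) := by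
    have := hfin ξ hξ
    have := hfin (-ξ) hξ.neg
    refine ext_of_forall_integral_eq_of_IsFiniteMeasure fun f => ?_
    rw [hint ξ hξm, hint (-ξ) hξm.neg, ← sub_eq_zero,
      ← integral_sub (hmul ξ hξm hξ f) (hmul (-ξ) hξm.neg hξ.neg f)]
    refine (integral_congr_ae (ae_of_all _ fun x => ?_)).trans (h f)
    have : max (ξ x) 0 - max (-ξ x) 0 = ξ x := by
      rcases le_total 0 (ξ x) with h0 | h0
      · rw [max_eq_left h0, max_eq_right (neg_nonpos.2 h0), sub_zero]
      · rw [max_eq_right h0, max_eq_left (neg_nonneg.2 h0)]; ring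
    simp only [Pi.neg_apply]
    rw [← sub_mul, this, mul_comm]
  have happly : ∀ a : Ω → ℝ, μ a B = ∫⁻ x in ρ ⁻¹' B, ENNReal.ofReal (a x) ∂Q := fun a => by
    rw [Measure.map_apply hρ hB, withDensity_apply _ (hρ hB)]
  rw [integral_eq_lintegral_pos_part_sub_lintegral_neg_part hξ.integrableOn, ← happly ξ,
    show ∫⁻ x in ρ ⁻¹' B, ENNReal.ofReal (-ξ x) ∂Q = μ (-ξ) B from (happly (-ξ)).symm, heq,
    sub_self]

variable {T d : ℕ} {K : Fin (T + 1) → Fin d → Set ℝ}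

/-- The path segment up to date `t`. -/
def hist (K : Fin (T + 1) → Fin d → Set ℝ) (t : Fin (T + 1)) (x : Omega K) : History K t :=
  fun s => x s

/-- The increment of the price of stock `j` between the dates `t` and `t + 1`. -/
def increment (K : Fin (T + 1) → Fin d → Set ℝ) (t : Fin T) (j : Fin d) (x : Omega K) : ℝ :=
  (x t.succ j : ℝ) - (x t.castSucc j : ℝ)

theorem stochInt_eq (Δ : Strategy K) (x : Omega K) :
    stochInt Δ x = ∑ t, ∑ j, Δ t j (hist K t.castSucc x) * increment K t j x := rfl

theorem continuous_hist (t : Fin (T + 1)) : Continuous (hist K t) :=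
  continuous_pi fun s => continuous_apply (s : Fin (T + 1))

theorem continuous_price (t : Fin (T + 1)) (j : Fin d) :
    Continuous fun x : Omega K => (x t j : ℝ) :=
  continuous_subtype_val.comp ((continuous_apply j).comp (continuous_apply t))

theorem continuous_increment (t : Fin T) (j : Fin d) : Continuous (increment K t j) :=
  (continuous_price _ _).sub (continuous_price _ _)

theorem measurable_canon_canonFiltration {s t : Fin (T + 1)} (hst : s ≤ t) :
    Measurable[canonFiltration K t] (canon K s) :=
  ((Filtration.stronglyAdapted_natural (stronglyMeasurable_canon K) s).measurable).mono
    ((canonFiltration K).mono hst) le_rfl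

theorem measurable_hist_canonFiltration (t : Fin (T + 1)) :
    Measurable[canonFiltration K t] (hist K t) := by
  refine @measurable_pi_lambda _ _ _ (canonFiltration K t) _ _ fun s => ?_
  refine @measurable_pi_lambda _ _ _ (canonFiltration K t) _ _ fun j => ?_
  exact Measurable.subtype_mk ((measurable_pi_apply j).comp (measurable_canon_canonFiltration s.2))

/-- The natural filtration is generated by the real-valued path segment, which factors through the
segment with values in the sets `K s j`. This turns past events into preimages to which test
functions on histories apply. -/
theorem exists_eq_preimage_hist {t : Fin (T + 1)} {A : Set (Omega K)}
    (hA : MeasurableSet[canonFiltration K t] A) :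
    ∃ B : Set (History K t), MeasurableSet B ∧ hist K t ⁻¹' B = A := by
  rw [canonFiltration, Filtration.natural_eq_comap] at hA
  obtain ⟨B, hB, rfl⟩ := hA
  refine ⟨(fun y (s : Set.Iic t) (j : Fin d) => (y s j : ℝ)) ⁻¹' B, ?_, rfl⟩
  refine Measurable.comp (g := fun y : (s : Set.Iic t) → Fin d → ℝ => y) measurable_id ?_ hB
  refine measurable_pi_lambda _ fun s => measurable_pi_lambda _ fun j => ?_
  exact measurable_subtype_coe.comp ((measurable_pi_apply j).comp (measurable_pi_apply s))

theorem integrable_hist_mul_increment {Q : Measure (Omega K)}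
    (hQ : ∀ t j, Integrable (fun x : Omega K => (x t j : ℝ)) Q) (t : Fin T) (j : Fin d)
    (f : History K t.castSucc →ᵇ ℝ) :
    Integrable (fun x => f (hist K t.castSucc x) * increment K t j x) Q :=
  ((hQ _ _).sub (hQ _ _)).bdd_mul (c := ‖f‖)
    (f.continuous.comp (continuous_hist _)).measurable.aestronglyMeasurable
    (ae_of_all _ fun _ => f.norm_coe_le_norm _)

theorem integrable_price_of_mem_Mart {Q : Measure (Omega K)} (hQ : Q ∈ Mart K)
    (t : Fin (T + 1)) (j : Fin d) : Integrable (fun x : Omega K => (x t j : ℝ)) Q :=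
  (hQ.2 j).integrable t

/-- The position is known at the earlier date, so it can be taken out of the conditional
expectation, and the conditional mean of the increment is zero. -/
theorem integral_hist_mul_increment {Q : Measure (Omega K)} (hQ : Q ∈ Mart K) (t : Fin T)
    (j : Fin d) (f : History K t.castSucc →ᵇ ℝ) :
    ∫ x, f (hist K t.castSucc x) * increment K t j x ∂Q = 0 := by
  have := hQ.1
  have hi := integrable_price_of_mem_Mart hQ
  have hle := (canonFiltration K).le t.castSucc
  have h1 : Q[increment K t j | canonFiltration K t.castSucc] =ᵐ[Q] 0 := by
    have h2 := condExp_sub (hi t.succ j) (hi t.castSucc j) (canonFiltration K t.castSucc)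
    have h3 := (hQ.2 j).condExp_ae_eq (Fin.castSucc_le_succ t)
    have h4 := (hQ.2 j).condExp_ae_eq (le_refl t.castSucc)
    filter_upwards [h2, h3, h4] with x h2 h3 h4
    refine h2.trans ?_
    rw [Pi.sub_apply]
    refine (congrArg₂ (· - ·) h3 h4).trans ?_
    exact sub_self _
  have hf : StronglyMeasurable[canonFiltration K t.castSucc]
      fun x => f (hist K t.castSucc x) :=
    (f.continuous.measurable.comp (measurable_hist_canonFiltration _)).stronglyMeasurable
  have h5 := condExp_mul_of_stronglyMeasurable_left hf
    (integrable_hist_mul_increment hi t j f) ((hi t.succ j).sub (hi t.castSucc j))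
  rw [← integral_condExp hle]
  refine integral_eq_zero_of_ae ?_
  filter_upwards [h5, h1] with x h5 h1
  refine h5.trans ?_
  rw [Pi.mul_apply]
  refine (congrArg _ h1).trans ?_
  simp

theorem integrable_stochInt {Q : Measure (Omega K)}
    (hQ : ∀ t j, Integrable (fun x : Omega K => (x t j : ℝ)) Q) (Δ : Strategy K) :
    Integrable (stochInt Δ) Q :=
  integrable_finsetSum _ fun t _ => integrable_finsetSum _ fun j _ =>
    integrable_hist_mul_increment hQ t j (Δ t j)

theorem integral_stochInt {Q : Measure (Omega K)} (hQ : Q ∈ Mart K) (Δ : Strategy K) :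
    ∫ x, stochInt Δ x ∂Q = 0 := by
  have hi := integrable_hist_mul_increment (integrable_price_of_mem_Mart hQ)
  simp only [stochInt_eq]
  rw [integral_finsetSum _ fun t _ => integrable_finsetSum _ fun j _ => hi t j (Δ t j)]
  refine Finset.sum_eq_zero fun t _ => ?_
  rw [integral_finsetSum _ fun j _ => hi t j (Δ t j)]
  exact Finset.sum_eq_zero fun j _ => integral_hist_mul_increment hQ t j (Δ t j)

/-- A probability measure is a martingale measure if the price increments are orthogonal to the
bounded continuous functions of the past. -/
theorem mem_Mart_of_integral_eq_zero {Q : Measure (Omega K)} [IsProbabilityMeasure Q]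
    (hi : ∀ t j, Integrable (fun x : Omega K => (x t j : ℝ)) Q)
    (h : ∀ (t : Fin T) (j : Fin d) (f : History K t.castSucc →ᵇ ℝ),
      ∫ x, f (hist K t.castSucc x) * increment K t j x ∂Q = 0) : Q ∈ Mart K := by
  refine ⟨inferInstance, fun j => ⟨fun t => ?_, fun s t hst => ?_⟩⟩
  · exact ((measurable_pi_apply j).comp
      (measurable_canon_canonFiltration (le_refl t))).stronglyMeasurable
  · have hset : ∀ A, MeasurableSet[canonFiltration K s] A →
        ∫ x in A, canon K s x j ∂Q = ∫ x in A, canon K t x j ∂Q := fun A hA => by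
      -- The hypothesis concerns one-step increments only; an event of date `s` is also one of date
      -- `t.castSucc`, so the steps can be chained.
      induction t using Fin.induction with
      | zero => rw [le_antisymm hst (Fin.zero_le s)]
      | succ t ih =>
        rcases hst.eq_or_lt with rfl | hlt
        · rfl
        · have hst' : s ≤ t.castSucc := Fin.le_castSucc_iff.2 hlt
          rw [ih hst']
          obtain ⟨B, hB, rfl⟩ := exists_eq_preimage_hist ((canonFiltration K).mono hst' A hA)
          have h0 := setIntegral_preimage_eq_zero (continuous_hist t.castSucc).measurable
            (continuous_increment t j).measurable ((hi t.succ j).sub (hi t.castSucc j))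
            (h t j) hB
          have h1 := integral_sub (hi t.succ j).integrableOn (hi t.castSucc j).integrableOn
            (μ := Q.restrict (hist K t.castSucc ⁻¹' B))
          exact (sub_eq_zero.1 (h1.symm.trans h0)).symm
    refine (ae_eq_condExp_of_forall_setIntegral_eq ((canonFiltration K).le s) (hi t j)
      (fun A _ _ => (hi s j).integrableOn) (fun A hA _ => hset A hA) ?_).symm
    exact ((measurable_pi_apply j).comp
      (measurable_canon_canonFiltration (le_refl s))).stronglyMeasurable.aestronglyMeasurable

end

section

/-! ### The weight on the path space -/

variable {T d : ℕ} {K : Fin (T + 1) → Fin d → Set ℝ}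

/-- The weight `1 + ∑ |x_t^j|`. -/
def weight (K : Fin (T + 1) → Fin d → Set ℝ) (x : Omega K) : ℝ :=
  1 + ∑ t, ∑ j, |(x t j : ℝ)|

theorem continuous_weight : Continuous (weight K) :=
  continuous_const.add (continuous_finsetSum _ fun t _ => continuous_finsetSum _ fun j _ =>
    (continuous_price t j).abs)

theorem one_add_slice_le_weight (x : Omega K) (t : Fin (T + 1)) :
    1 + ∑ j, |(x t j : ℝ)| ≤ weight K x :=
  add_le_add_right (Finset.single_le_sum (f := fun t => ∑ j, |(x t j : ℝ)|)
    (fun _ _ => Finset.sum_nonneg fun _ _ => abs_nonneg _) (Finset.mem_univ t)) 1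

theorem one_le_weight (x : Omega K) : 1 ≤ weight K x :=
  le_add_of_nonneg_right
    (Finset.sum_nonneg fun _ _ => Finset.sum_nonneg fun _ _ => abs_nonneg _)

theorem abs_price_le_weight (x : Omega K) (t : Fin (T + 1)) (j : Fin d) :
    |(x t j : ℝ)| ≤ weight K x := by
  have h1 : |(x t j : ℝ)| ≤ ∑ j, |(x t j : ℝ)| :=
    Finset.single_le_sum (f := fun j => |(x t j : ℝ)|) (fun _ _ => abs_nonneg _)
      (Finset.mem_univ j)
  linarith [one_add_slice_le_weight x t]

theorem isClosedEmbedding_coe (hK : ∀ t j, IsClosed (K t j)) :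
    IsClosedEmbedding fun (x : Omega K) t j => (x t j : ℝ) :=
  .piMap fun t => .piMap fun j => (hK t j).isClosedEmbedding_subtypeVal

/-- The path space is closed in a finite-dimensional space, and the sublevel set lies in a box. -/
theorem isCompact_weight_le (hK : ∀ t j, IsClosed (K t j)) (r : ℝ) :
    IsCompact {x : Omega K | weight K x ≤ r} := by
  refine ((isClosedEmbedding_coe hK).isCompact_preimage (isCompact_univ_pi fun _ =>
    isCompact_univ_pi fun _ => isCompact_Icc (a := -r) (b := r))).of_isClosed_subset
    (isClosed_le continuous_weight continuous_const) fun x hx => ?_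
  exact fun t _ j _ => abs_le.1 ((abs_price_le_weight x t j).trans hx)

theorem integrable_weight {Q : Measure (Omega K)} [IsFiniteMeasure Q]
    (hQ : ∀ t j, Integrable (fun x : Omega K => (x t j : ℝ)) Q) : Integrable (weight K) Q :=
  (integrable_const 1).add (integrable_finsetSum _ fun t _ => integrable_finsetSum _ fun j _ =>
    (hQ t j).abs)

theorem integrable_growthSpace {Q : Measure (Omega K)} (hQ : Integrable (weight K) Q)
    {g : Omega K → ℝ} (hg : g ∈ growthSpace (weight K)) : Integrable g Q := by
  obtain ⟨hgc, M, hM⟩ := hg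
  exact (hQ.const_mul M).mono' hgc.measurable.aestronglyMeasurable (ae_of_all _ hM)

theorem price_mem_growthSpace (t : Fin (T + 1)) (j : Fin d) :
    (fun x : Omega K => (x t j : ℝ)) ∈ growthSpace (weight K) :=
  ⟨continuous_price t j, 1, fun x => by rw [one_mul]; exact abs_price_le_weight x t j⟩

theorem one_mem_growthSpace : (1 : Omega K → ℝ) ∈ growthSpace (weight K) :=
  ⟨continuous_const, 1, fun x => by simpa using one_le_weight x⟩

theorem weight_mem_growthSpace : weight K ∈ growthSpace (weight K) :=
  ⟨continuous_weight, 1, fun x => by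
    rw [one_mul, abs_of_nonneg (zero_le_one.trans (one_le_weight x))]⟩

theorem hist_mul_increment_mem_growthSpace (t : Fin T) (j : Fin d)
    (f : History K t.castSucc →ᵇ ℝ) :
    (fun x => f (hist K t.castSucc x) * increment K t j x) ∈ growthSpace (weight K) := by
  refine ⟨(f.continuous.comp (continuous_hist _)).mul (continuous_increment t j), ‖f‖ * 2,
    fun x => ?_⟩
  rw [abs_mul, mul_assoc]
  refine mul_le_mul (f.norm_coe_le_norm _) ((abs_sub _ _).trans ?_) (abs_nonneg _) (norm_nonneg _)
  linarith [abs_price_le_weight x t.succ j, abs_price_le_weight x t.castSucc j]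

theorem stochInt_mem_growthSpace (Δ : Strategy K) : stochInt Δ ∈ growthSpace (weight K) := by
  have h : stochInt Δ
      = ∑ t, ∑ j, fun x => Δ t j (hist K t.castSucc x) * increment K t j x := by
    ext x
    simp only [Finset.sum_apply]
    rfl
  rw [h]
  exact Submodule.sum_mem _ fun t _ => Submodule.sum_mem _ fun j _ =>
    hist_mul_increment_mem_growthSpace t j (Δ t j)

theorem stochInt_add_smul (a b : ℝ) (Δ Δ' : Strategy K) (x : Omega K) :
    stochInt (a • Δ + b • Δ') x = a * stochInt Δ x + b * stochInt Δ' x := by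
  simp only [stochInt, Finset.mul_sum, ← Finset.sum_add_distrib]
  refine Finset.sum_congr rfl fun t _ => Finset.sum_congr rfl fun j _ => ?_
  simp only [Pi.add_apply, Pi.smul_apply, BoundedContinuousFunction.coe_add,
    BoundedContinuousFunction.coe_smul, smul_eq_mul]
  ring

theorem stochInt_zero (x : Omega K) : stochInt (0 : Strategy K) x = 0 := by
  simp [stochInt]

theorem stochInt_neg (Δ : Strategy K) (x : Omega K) : stochInt (-Δ) x = -stochInt Δ x := by
  simp [stochInt]

/-- Trading one stock at one date isolates a single orthogonality relation from the vanishing of a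
functional on all gains. -/
theorem stochInt_single (t : Fin T) (j : Fin d) (f : History K t.castSucc →ᵇ ℝ) :
    stochInt (Pi.single t (Pi.single j f) : Strategy K)
      = fun x => f (hist K t.castSucc x) * increment K t j x := by
  ext x
  rw [stochInt_eq, Finset.sum_eq_single t, Finset.sum_eq_single j]
  · simp
  · intro i _ hi
    simp [hi]
  · simp
  · intro s _ hs
    simp [Pi.single_eq_of_ne hs]
  · simp

/-! ### Static positions -/

section Static

variable {E : (t : Fin (T + 1)) → Submodule ℝ (Slice K t → ℝ)}

theorem comp_eval_mem_growthSpace (hEC : ∀ t, E t ≤ weightedC K t) (t : Fin (T + 1)) (φ : E t) :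
    (fun x : Omega K => (φ : Slice K t → ℝ) (x t)) ∈ growthSpace (weight K) := by
  obtain ⟨hφ, M, hM⟩ := hEC t φ.2
  refine ⟨hφ.comp (continuous_apply t), |M|, fun x => (hM (x t)).trans ?_⟩
  have h0 : 0 ≤ ∑ j, |(x t j : ℝ)| := Finset.sum_nonneg fun _ _ => abs_nonneg _
  exact mul_le_mul (le_abs_self M) (one_add_slice_le_weight x t) (by positivity) (abs_nonneg M)

/-- The payoff of an option with maturity `t` as a function on the path space. -/
def payoff (hEC : ∀ t, E t ≤ weightedC K t) (t : Fin (T + 1)) :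
    E t →ₗ[ℝ] growthSpace (weight K) where
  toFun φ := ⟨_, comp_eval_mem_growthSpace hEC t φ⟩
  map_add' _ _ := rfl
  map_smul' _ _ := rfl

/-- The payoff of a static position. -/
def staticPayoff (hEC : ∀ t, E t ≤ weightedC K t) :
    ((t : Fin (T + 1)) → E t) →ₗ[ℝ] growthSpace (weight K) :=
  ∑ t, payoff hEC t ∘ₗ LinearMap.proj t

theorem staticPayoff_apply (hEC : ∀ t, E t ≤ weightedC K t) (φ : (t : Fin (T + 1)) → E t) :
    staticPayoff hEC φ = ∑ t, payoff hEC t (φ t) := by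
  simp [staticPayoff]

theorem staticPayoff_coe (hEC : ∀ t, E t ≤ weightedC K t) (φ : (t : Fin (T + 1)) → E t)
    (x : Omega K) :
    (staticPayoff hEC φ : Omega K → ℝ) x = ∑ t, (φ t : Slice K t → ℝ) (x t) := by
  rw [staticPayoff_apply, Submodule.coe_sum, Finset.sum_apply]
  rfl

theorem integral_marginal (hEC : ∀ t, E t ≤ weightedC K t) (Q : Measure (Omega K))
    (t : Fin (T + 1)) (φ : E t) :
    ∫ y, (φ : Slice K t → ℝ) y ∂(marginal Q t) = ∫ x, (payoff hEC t φ : Omega K → ℝ) x ∂Q :=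
  integral_map (measurable_pi_apply t).aemeasurable
    (hEC t φ.2).1.measurable.aestronglyMeasurable

theorem integral_staticPayoff (hEC : ∀ t, E t ≤ weightedC K t) {Q : Measure (Omega K)}
    (hQ : Integrable (weight K) Q) (φ : (t : Fin (T + 1)) → E t) :
    ∫ x, (staticPayoff hEC φ : Omega K → ℝ) x ∂Q
      = ∑ t, ∫ y, (φ t : Slice K t → ℝ) y ∂(marginal Q t) := by
  simp only [integral_marginal hEC, staticPayoff_apply, Submodule.coe_sum, Finset.sum_apply]
  exact integral_finsetSum _ fun t _ => integrable_growthSpace hQ (payoff hEC t (φ t)).2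

/-! ### Weak duality and the form of the primal value -/

variable {S : (t : Fin (T + 1)) → E t → ℝ} {c : Omega K → EReal}

theorem coe_finsetSum {ι : Type*} (s : Finset ι) (a : ι → ℝ) :
    ((∑ i ∈ s, a i : ℝ) : EReal) = ∑ i ∈ s, (a i : EReal) :=
  map_sum (⟨⟨Real.toEReal, EReal.coe_zero⟩, EReal.coe_add⟩ : ℝ →+ EReal) a s

theorem weak_duality (hEC : ∀ t, E t ≤ weightedC K t) {Q : Measure (Omega K)} (hQ : Q ∈ Mart K)
    {φ : (t : Fin (T + 1)) → E t} {Δ : Strategy K}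
    (h : ∀ x, ((∑ t, (φ t : Slice K t → ℝ) (x t) + stochInt Δ x : ℝ) : EReal) ≤ c x) :
    ((∑ t, S t (φ t) : ℝ) : EReal) ≤ expect Q c + ∑ t, penalty (S t) (marginal Q t) := by
  have := hQ.1
  have hi := integrable_price_of_mem_Mart hQ
  have hw := integrable_weight hi
  have hφ := integrable_growthSpace hw (staticPayoff hEC φ).2
  have h1 : ((∑ t, ∫ y, (φ t : Slice K t → ℝ) y ∂(marginal Q t) : ℝ) : EReal) ≤ expect Q c := by
    have h2 := integral_le_expect (hφ.add (integrable_stochInt hi Δ)) (c := c) fun x => by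
      rw [Pi.add_apply, staticPayoff_coe]
      exact h x
    rwa [integral_add' hφ (integrable_stochInt hi Δ), integral_stochInt hQ, add_zero,
      integral_staticPayoff hEC hw] at h2
  have h2 : ((∑ t, (S t (φ t) - ∫ y, (φ t : Slice K t → ℝ) y ∂(marginal Q t)) : ℝ) : EReal)
      ≤ ∑ t, penalty (S t) (marginal Q t) := by
    rw [coe_finsetSum]
    exact Finset.sum_le_sum fun t _ => le_iSup
      (fun φ : E t => ((S t φ - ∫ y, (φ : Slice K t → ℝ) y ∂(marginal Q t) : ℝ) : EReal)) (φ t)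
  refine le_trans (le_of_eq ?_) (add_le_add h1 h2)
  rw [← EReal.coe_add, Finset.sum_sub_distrib, add_sub_cancel]

/-- The choices at different indices are independent, so near-maximizers can be combined. Fixing all
coordinates but one shows that each supremum is finite, which permits working in `ℝ`. -/
theorem sum_iSup_coe_le {ι : Type*} [Fintype ι] {α : ι → Type*} [∀ i, Nonempty (α i)]
    {a : (i : ι) → α i → ℝ} {v : ℝ} (h : ∀ φ : (i : ι) → α i, ∑ i, a i (φ i) ≤ v) :
    ∑ i, ⨆ y, ((a i y : ℝ) : EReal) ≤ (v : EReal) := by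
  classical
  have hbdd : ∀ i, BddAbove (Set.range (a i)) := fun i => by
    let φ : (i : ι) → α i := fun i => Classical.arbitrary _
    refine ⟨v - ∑ k ∈ Finset.univ.erase i, a k (φ k), ?_⟩
    rintro _ ⟨y, rfl⟩
    have h0 := h (Function.update φ i y)
    rw [← Finset.add_sum_erase _ _ (Finset.mem_univ i), Function.update_self] at h0
    rw [Finset.sum_congr rfl fun k hk => by
      rw [Function.update_of_ne (Finset.ne_of_mem_erase hk)]] at h0
    linarith
  have h1 : ∑ i, ⨆ y, a i y ≤ v := by
    refine le_of_forall_pos_le_add fun ε hε => ?_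
    have hδ : 0 < ε / (Fintype.card ι + 1) := by positivity
    choose φ hφ using fun i => exists_lt_of_lt_ciSup
      (sub_lt_self (⨆ y, a i y) hδ)
    have h2 := Finset.sum_le_sum fun i (_ : i ∈ Finset.univ) => (hφ i).le
    rw [Finset.sum_sub_distrib, Finset.sum_const, Finset.card_univ, nsmul_eq_mul] at h2
    have h3 : Fintype.card ι * (ε / (Fintype.card ι + 1)) ≤ ε := by
      rw [mul_div_assoc', div_le_iff₀ (by positivity)]
      nlinarith
    linarith [h φ]
  refine le_trans ?_ (EReal.coe_le_coe_iff.2 h1)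
  rw [coe_finsetSum]
  exact Finset.sum_le_sum fun i _ => iSup_le fun y =>
    EReal.coe_le_coe_iff.2 (le_ciSup (hbdd i) y)

theorem additiveU_add_const (h1 : ∀ t, (1 : Slice K t → ℝ) ∈ E t)
    (hcash : ∀ t, CashAdditive (h1 t) (S t)) (φ : (t : Fin (T + 1)) → E t)
    (β : Fin (T + 1) → ℝ) :
    ∑ t, S t (φ t + β t • ⟨1, h1 t⟩) = ∑ t, S t (φ t) + ∑ t, β t := by
  rw [← Finset.sum_add_distrib]
  exact Finset.sum_congr rfl fun t _ => hcash t (φ t) (β t)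

/-- By cash additivity the expression inside the supremum does not depend on `β`. -/
theorem oce_additiveU (h1 : ∀ t, (1 : Slice K t → ℝ) ∈ E t)
    (hcash : ∀ t, CashAdditive (h1 t) (S t)) (φ : (t : Fin (T + 1)) → E t) :
    oce h1 (additiveU S) φ = ((∑ t, S t (φ t) : ℝ) : EReal) := by
  have h : ∀ β : Fin (T + 1) → ℝ,
      additiveU S (fun t => φ t + β t • ⟨1, h1 t⟩) - ((∑ t, β t : ℝ) : EReal)
        = ((∑ t, S t (φ t) : ℝ) : EReal) := fun β => by
    rw [additiveU, ← EReal.coe_sub, additiveU_add_const h1 hcash, add_sub_cancel_right]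
  rw [oce, iSup_congr h, iSup_const]

theorem primalValue_additiveU (h1 : ∀ t, (1 : Slice K t → ℝ) ∈ E t)
    (hcash : ∀ t, CashAdditive (h1 t) (S t)) :
    primalValue h1 (additiveU S) (Set.range stochInt) c =
      sSup {v : EReal | ∃ φ : (t : Fin (T + 1)) → E t,
        (∃ Δ : Strategy K, ∀ x : Omega K,
          ((∑ t, (φ t : Slice K t → ℝ) (x t) + stochInt Δ x : ℝ) : EReal) ≤ c x) ∧
        v = ((∑ t, S t (φ t) : ℝ) : EReal)} := by
  refine le_antisymm ?_ (sSup_le ?_)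
  · refine iSup₂_le fun z hz => iSup₂_le fun φ hφ => ?_
    rw [oce_additiveU h1 hcash]
    obtain ⟨Δ, hΔ⟩ := hz
    -- The primal value uses `z ∈ -𝓘`; the gains form a set closed under negation, so the sign is
    -- absorbed by the strategy.
    refine le_sSup ⟨φ, ⟨-Δ, fun x => ?_⟩, rfl⟩
    rw [stochInt_neg, hΔ, Pi.neg_apply, neg_neg]
    exact hφ.2 x
  · rintro v ⟨φ, ⟨Δ, hΔ⟩, rfl⟩
    rw [← oce_additiveU h1 hcash]
    refine le_iSup₂_of_le (stochInt Δ) ⟨-Δ, funext fun x => stochInt_neg Δ x⟩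
      (le_iSup₂_of_le φ ⟨?_, hΔ⟩ le_rfl)
    rw [oce_additiveU h1 hcash]
    exact EReal.bot_lt_coe _

end Static

end

section

/-! ### Existence of an optimal martingale measure -/

variable {T d : ℕ} {K : Fin (T + 1) → Fin d → Set ℝ}
  {E : (t : Fin (T + 1)) → Submodule ℝ (Slice K t → ℝ)}
  {S : (t : Fin (T + 1)) → E t → ℝ} {c : Omega K → EReal}

/-- The pairs `(h, u)` for which `c + h` can be subhedged by a portfolio of value at least `u`. -/
def hedgeRelation (S : (t : Fin (T + 1)) → E t → ℝ) (c : Omega K → EReal) :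
    Set (growthSpace (weight K) × ℝ) :=
  {p | ∃ (φ : (t : Fin (T + 1)) → E t) (Δ : Strategy K), p.2 ≤ ∑ t, S t (φ t) ∧
    ∀ x, ((∑ t, (φ t : Slice K t → ℝ) (x t) + stochInt Δ x - (p.1 : Omega K → ℝ) x : ℝ) : EReal)
      ≤ c x}

theorem convex_hedgeRelation (hconc : ∀ t, ConcaveOn ℝ Set.univ (S t)) :
    Convex ℝ (hedgeRelation S c) := by
  rintro ⟨g, u⟩ ⟨φ, Δ, hu, h⟩ ⟨g', u'⟩ ⟨φ', Δ', hu', h'⟩ a b ha hb hab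
  refine ⟨a • φ + b • φ', a • Δ + b • Δ', ?_, fun x => ?_⟩
  · have h1 : a * ∑ t, S t (φ t) + b * ∑ t, S t (φ' t) ≤ ∑ t, S t ((a • φ + b • φ') t) := by
      rw [Finset.mul_sum, Finset.mul_sum, ← Finset.sum_add_distrib]
      exact Finset.sum_le_sum fun t _ =>
        (hconc t).2 (Set.mem_univ _) (Set.mem_univ _) ha hb hab
    refine le_trans ?_ h1
    exact add_le_add (mul_le_mul_of_nonneg_left hu ha) (mul_le_mul_of_nonneg_left hu' hb)
  · refine le_trans (EReal.coe_le_coe_iff.2 ?_)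
      ((EReal.coe_strictMono.monotone.map_max).trans_le (max_le (h x) (h' x)))
    have h1 : ∑ t, ((a • φ + b • φ') t : Slice K t → ℝ) (x t)
        = a * ∑ t, (φ t : Slice K t → ℝ) (x t) + b * ∑ t, (φ' t : Slice K t → ℝ) (x t) := by
      rw [Finset.mul_sum, Finset.mul_sum, ← Finset.sum_add_distrib]
      rfl
    have h2 : ((a • (g, u) + b • (g', u')).1 : Omega K → ℝ) x
        = a * (g : Omega K → ℝ) x + b * (g' : Omega K → ℝ) x := rfl
    rw [h1, h2, stochInt_add_smul]
    refine le_trans (le_of_eq ?_) ((add_le_add (mul_le_mul_of_nonneg_left (le_max_left _ _) ha)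
      (mul_le_mul_of_nonneg_left (le_max_right _ _) hb)).trans
      (by rw [← add_mul, hab, one_mul]))
    ring

/-- Outside a sublevel set, the weight is dominated by the instruments. -/
theorem exists_dominating_level {C : (t : Fin (T + 1)) → Set (Slice K t)}
    (hC : ∀ t, IsCompact (C t)) {f : (t : Fin (T + 1)) → E t}
    (h : ∀ x : Omega K, ¬ (∀ t, x t ∈ C t) →
      1 + ∑ t, ∑ j, |(x t j : ℝ)| ≤ ∑ t, (f t : Slice K t → ℝ) (x t)) :
    ∃ r : ℝ, 0 ≤ r ∧ ∀ x, r < weight K x →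
      weight K x ≤ ∑ t, (f t : Slice K t → ℝ) (x t) := by
  obtain ⟨r, hr⟩ := ((isCompact_univ_pi hC).image (continuous_weight (K := K))).bddAbove
  refine ⟨max r 0, le_max_right _ _, fun x hx => h x fun hxC => ?_⟩
  have := hr ⟨x, fun t _ => hxC t, rfl⟩
  exact absurd hx (not_lt.2 (this.trans (le_max_left _ _)))

theorem add_const_apply {X : Type*} {F : Submodule ℝ (X → ℝ)} (h1 : (1 : X → ℝ) ∈ F) (φ : F)
    (b : ℝ) (y : X) : ((φ + b • ⟨1, h1⟩ : F) : X → ℝ) y = (φ : X → ℝ) y + b := by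
  simp

/-- The instruments plus the constant `r` dominate the weight everywhere, so a large enough short
position in them lies below `c + g`. This supplies the nonempty fibres for Hahn-Banach and, at `g =
0`, a first subhedge of `c`. -/
theorem exists_mem_hedgeRelation (h1 : ∀ t, (1 : Slice K t → ℝ) ∈ E t)
    {f : (t : Fin (T + 1)) → E t} (hf : ∀ t y, 0 ≤ (f t : Slice K t → ℝ) y)
    {r : ℝ} (hr : 0 ≤ r) (hfr : ∀ x : Omega K, r < weight K x →
      weight K x ≤ ∑ t, (f t : Slice K t → ℝ) (x t))
    {A : ℝ} (hA : 0 ≤ A) (hlow : ∀ x, ((-(A * weight K x) : ℝ) : EReal) ≤ c x)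
    (g : growthSpace (weight K)) : ∃ u, (g, u) ∈ hedgeRelation S c := by
  obtain ⟨-, M, hM⟩ := g.2
  let φ : (t : Fin (T + 1)) → E t := fun t => -((A + |M|) • (f t + r • ⟨1, h1 t⟩))
  refine ⟨_, φ, 0, le_rfl, fun x => (EReal.coe_le_coe_iff.2 ?_).trans (hlow x)⟩
  have hsum : ∑ t, (φ t : Slice K t → ℝ) (x t)
      = -((A + |M|) * ∑ t, ((f t : Slice K t → ℝ) (x t) + r)) := by
    rw [Finset.mul_sum, ← Finset.sum_neg_distrib]
    refine Finset.sum_congr rfl fun t _ => ?_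
    simp only [φ, Submodule.coe_neg, Submodule.coe_smul, Pi.neg_apply, Pi.smul_apply, smul_eq_mul,
      add_const_apply]
  have hw : weight K x ≤ ∑ t, ((f t : Slice K t → ℝ) (x t) + r) := by
    rcases le_or_gt (weight K x) r with h | h
    · have := Finset.single_le_sum (f := fun t => (f t : Slice K t → ℝ) (x t) + r)
        (fun t _ => add_nonneg (hf t (x t)) hr) (Finset.mem_univ 0)
      exact (h.trans (le_add_of_nonneg_left (hf 0 (x 0)))).trans this
    · exact (hfr x h).trans (Finset.sum_le_sum fun _ _ => le_add_of_nonneg_right hr)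
  rw [hsum, stochInt_zero]
  have h2 := mul_le_mul_of_nonneg_left hw (add_nonneg hA (abs_nonneg M))
  have h3 : -(g : Omega K → ℝ) x ≤ |M| * weight K x :=
    (neg_le_abs _).trans ((hM x).trans (mul_le_mul_of_nonneg_right (le_abs_self M)
      (zero_le_one.trans (one_le_weight x))))
  linarith

/-- A supporting functional of the hedging relation is a pricing functional: positive, normalized,
and zero on the gains of dynamic strategies. -/
theorem exists_pricing_functional (hEC : ∀ t, E t ≤ weightedC K t)
    (h1 : ∀ t, (1 : Slice K t → ℝ) ∈ E t) (hconc : ∀ t, ConcaveOn ℝ Set.univ (S t))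
    (hcash : ∀ t, CashAdditive (h1 t) (S t)) {m : ℝ}
    (hm : ∀ (φ : (t : Fin (T + 1)) → E t) (Δ : Strategy K),
      (∀ x, ((∑ t, (φ t : Slice K t → ℝ) (x t) + stochInt Δ x : ℝ) : EReal) ≤ c x) →
        ∑ t, S t (φ t) ≤ m)
    (hne : ∀ g, ∃ u, (g, u) ∈ hedgeRelation S c) :
    ∃ L : growthSpace (weight K) →ₗ[ℝ] ℝ,
      (∀ g : growthSpace (weight K), (∀ x, 0 ≤ (g : Omega K → ℝ) x) → 0 ≤ L g) ∧
      L ⟨1, one_mem_growthSpace⟩ = 1 ∧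
      (∀ Δ : Strategy K, L ⟨stochInt Δ, stochInt_mem_growthSpace Δ⟩ = 0) ∧
      ∀ (φ : (t : Fin (T + 1)) → E t) (g : growthSpace (weight K)),
        (∀ x, ((g : Omega K → ℝ) x : EReal) ≤ c x) →
          ∑ t, S t (φ t) ≤ m + L (staticPayoff hEC φ) - L g := by
  obtain ⟨L, hL⟩ := exists_supporting_functional (convex_hedgeRelation hconc) (m := m)
    (fun u ⟨φ, Δ, hu, h⟩ => hu.trans (hm φ Δ fun x => by simpa using h x)) hne
  obtain ⟨u, φ, Δ, hu, h⟩ := hne 0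
  have hφ : ∀ x, ((∑ t, (φ t : Slice K t → ℝ) (x t) + stochInt Δ x : ℝ) : EReal) ≤ c x :=
    fun x => by simpa using h x
  -- Adding `t` times a gain to `h` is offset by trading at no cost, so `u` stays attainable for
  -- every `t ≥ 0`.
  have hgain : ∀ Δ' : Strategy K, 0 ≤ L ⟨stochInt Δ', stochInt_mem_growthSpace Δ'⟩ := fun Δ' => by
    refine nonneg_of_forall_le_add_mul (b := m) (u := u) fun t _ => ?_
    rw [← smul_eq_mul, ← map_smul]
    refine hL _ _ ⟨φ, (1 : ℝ) • Δ + t • Δ', hu, fun x => ?_⟩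
    rw [stochInt_add_smul]
    refine (EReal.coe_le_coe_iff.2 (le_of_eq ?_)).trans (hφ x)
    rw [Submodule.coe_smul, Pi.smul_apply, smul_eq_mul]
    ring
  -- The whole amount `t` is added to the date-`0` option; letting `t` have both signs pins `L 1` to
  -- `1`.
  have hconst : ∀ t : ℝ, u + t ≤ m + t * L ⟨1, one_mem_growthSpace⟩ := fun t => by
    rw [← smul_eq_mul, ← map_smul]
    refine hL _ _ ⟨fun s => φ s + (if s = 0 then t else 0) • ⟨1, h1 s⟩, Δ, ?_, fun x => ?_⟩
    · rw [additiveU_add_const h1 hcash φ fun s => if s = 0 then t else 0]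
      simpa using hu
    · refine (EReal.coe_le_coe_iff.2 (le_of_eq ?_)).trans (hφ x)
      simp only [add_const_apply, Finset.sum_add_distrib, Finset.sum_ite_eq', Finset.mem_univ,
        if_true, Submodule.coe_smul, Pi.smul_apply, Pi.one_apply, smul_eq_mul]
      ring
  refine ⟨L, fun g hg => ?_, le_antisymm ?_ ?_, fun Δ' => le_antisymm ?_ (hgain Δ'), ?_⟩
  · refine nonneg_of_forall_le_add_mul (b := m) (u := u) fun t ht => ?_
    rw [← smul_eq_mul, ← map_smul]
    refine hL _ _ ⟨φ, Δ, hu, fun x => (EReal.coe_le_coe_iff.2 ?_).trans (hφ x)⟩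
    exact sub_le_self _ (mul_nonneg ht (hg x))
  · have := nonneg_of_forall_le_add_mul (a := 1 - L ⟨1, one_mem_growthSpace⟩) (b := m) (u := u)
      fun t _ => by linarith [hconst (-t)]
    linarith
  · have := nonneg_of_forall_le_add_mul (a := L ⟨1, one_mem_growthSpace⟩ - 1) (b := m) (u := u)
      fun t _ => by linarith [hconst t]
    linarith
  · have h2 := hgain (-Δ')
    have h3 : (⟨stochInt (-Δ'), stochInt_mem_growthSpace _⟩ : growthSpace (weight K))
        = -⟨stochInt Δ', stochInt_mem_growthSpace _⟩ := by
      ext x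
      exact stochInt_neg Δ' x
    rw [h3, map_neg] at h2
    linarith
  · intro ψ g hg
    -- The position `ψ` subhedges `c + (ψ - g)` because `g ≤ c`.
    have h2 := hL (staticPayoff hEC ψ - g) (∑ t, S t (ψ t)) ⟨ψ, 0, le_rfl, fun x => ?_⟩
    · rw [map_sub] at h2
      linarith
    · refine le_trans (le_of_eq ?_) (hg x)
      rw [Submodule.coe_sub, Pi.sub_apply, staticPayoff_coe, stochInt_zero]
      simp

theorem tendsto_sum_of_convexV {f : ℕ → (t : Fin (T + 1)) → E t} {Γ : ℝ}
    (h : Tendsto (fun n => convexV (additiveU S) (fun t => Γ • f n t)) atTop (𝓝 0)) :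
    Tendsto (fun n => -∑ t, S t (-(Γ • f n t))) atTop (𝓝 0) := by
  rw [← EReal.tendsto_coe]
  exact h

/-- A functional that dominates the concave functional `∑ t, S t` up to a constant vanishes
asymptotically along the tail instruments. -/
theorem tendsto_functional_staticPayoff (hEC : ∀ t, E t ≤ weightedC K t)
    {L : growthSpace (weight K) →ₗ[ℝ] ℝ}
    (hL : ∀ g : growthSpace (weight K), (∀ x, 0 ≤ (g : Omega K → ℝ) x) → 0 ≤ L g) {b : ℝ}
    (hb : ∀ φ : (t : Fin (T + 1)) → E t, ∑ t, S t (φ t) ≤ b + L (staticPayoff hEC φ))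
    {f : ℕ → (t : Fin (T + 1)) → E t} (hf : ∀ n t y, 0 ≤ (f n t : Slice K t → ℝ) y)
    (h : ∀ Γ : ℝ, 0 < Γ →
      Tendsto (fun n => convexV (additiveU S) (fun t => Γ • f n t)) atTop (𝓝 0)) :
    Tendsto (fun n => L (staticPayoff hEC (f n))) atTop (𝓝 0) := by
  have h0 : ∀ n, 0 ≤ L (staticPayoff hEC (f n)) := fun n => hL _ fun x => by
    rw [staticPayoff_coe]
    exact Finset.sum_nonneg fun t _ => hf n t _
  rw [Metric.tendsto_atTop']
  intro ε hε
  -- Applying `hb` to `-Γ f` gives `Γ * L f ≤ b + V(Γ f)`, which is eventually below `|b| + 1`; this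
  -- `Γ` turns the bound into `L f < ε`.
  have hΓ : 0 < (|b| + 1) / ε := by positivity
  obtain ⟨N, hN⟩ := ((tendsto_sum_of_convexV (h _ hΓ)).eventually
    (gt_mem_nhds one_pos)).exists_forall_of_atTop
  refine ⟨N, fun n hn => ?_⟩
  rw [Real.dist_0_eq_abs, abs_of_nonneg (h0 n)]
  have h2 := hb (-(((|b| + 1) / ε) • f n))
  rw [map_neg, map_neg, map_smul, map_smul, smul_eq_mul] at h2
  have h3 := hN n hn.le
  have h4 : (|b| + 1) / ε * L (staticPayoff hEC (f n)) < |b| + 1 := by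
    have h5 : -∑ t, S t ((-(((|b| + 1) / ε) • f n)) t) < 1 := h3
    linarith [le_abs_self b]
  rw [div_mul_eq_mul_div, div_lt_iff₀ hε] at h4
  exact lt_of_mul_lt_mul_left h4 (by positivity)

/-- If the primal value is at most the real number `m` then there is a martingale measure with dual
value at most `m`. -/
theorem exists_martingale_measure_le (hK : ∀ t j, IsClosed (K t j))
    (hEC : ∀ t, E t ≤ weightedC K t)
    (h1 : ∀ t, (1 : Slice K t → ℝ) ∈ E t) (hconc : ∀ t, ConcaveOn ℝ Set.univ (S t))
    (hcash : ∀ t, CashAdditive (h1 t) (S t)) (htail : TailControl (additiveU S))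
    (hlsc : LowerSemicontinuous c) {A : ℝ} (hA : 0 ≤ A)
    (hlow : ∀ x, ((-(A * weight K x) : ℝ) : EReal) ≤ c x) {m : ℝ}
    (hm : ∀ (φ : (t : Fin (T + 1)) → E t) (Δ : Strategy K),
      (∀ x, ((∑ t, (φ t : Slice K t → ℝ) (x t) + stochInt Δ x : ℝ) : EReal) ≤ c x) →
        ∑ t, S t (φ t) ≤ m) :
    ∃ Q ∈ Mart K, expect Q c + ∑ t, penalty (S t) (marginal Q t) ≤ m := by
  obtain ⟨C, f, hC, hf0, hfC, hf⟩ := htail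
  choose r hr0 hr using fun n => exists_dominating_level (hC n) (hfC n)
  obtain ⟨L, hLpos, hL1, hLI, hL⟩ := exists_pricing_functional hEC h1 hconc hcash hm
    (exists_mem_hedgeRelation h1 (hf0 0) (hr0 0) (hr 0) hA hlow)
  -- The growth bound of `c` from below is itself an admissible `g`; it supplies the constant in the
  -- domination of `∑ S_t` by `L`, and later `E_Q[c] > ⊥`.
  let g₀ : growthSpace (weight K) := -(A • ⟨weight K, weight_mem_growthSpace⟩)
  have hg₀ : ∀ x, ((g₀ : Omega K → ℝ) x : EReal) ≤ c x := hlow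
  have hLf := tendsto_functional_staticPayoff hEC hLpos (b := m - L g₀)
    (fun φ => by linarith [hL φ g₀ hg₀]) hf0 hf
  have hloc : LocallyCompactSpace (Omega K) := (isClosedEmbedding_coe hK).locallyCompactSpace
  obtain ⟨Q, hQ⟩ := exists_measure_eq_of_tight continuous_weight one_le_weight
    (isCompact_weight_le hK) L hLpos (fun n => staticPayoff hEC (f n)) r
    (fun n x => by rw [staticPayoff_coe]; exact Finset.sum_nonneg fun t _ => hf0 n t _)
    (fun n x hx => by rw [staticPayoff_coe]; exact hr n x hx) hLf
  have hQ1 : IsProbabilityMeasure Q := by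
    have h2 := (hQ ⟨1, one_mem_growthSpace⟩).2
    rw [hL1] at h2
    simp only [Pi.one_apply, integral_const, smul_eq_mul, mul_one] at h2
    exact ⟨(ENNReal.toReal_eq_one_iff _).1 h2⟩
  have hw : Integrable (weight K) Q := (hQ ⟨weight K, weight_mem_growthSpace⟩).1
  have hMart : Q ∈ Mart K := by
    refine mem_Mart_of_integral_eq_zero (fun t j => integrable_growthSpace hw
      (price_mem_growthSpace t j)) fun t j f => ?_
    have h2 := (hQ _).2.trans (hLI (Pi.single t (Pi.single j f)))
    simpa only [stochInt_single] using h2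
  refine ⟨Q, hMart, ?_⟩
  -- For fixed `φ`, the supporting inequality bounds `∫ g dQ` uniformly over continuous `g ≤ c`, and
  -- hence bounds `E_Q[c]`. The case `φ = 0` makes `E_Q[c]` finite, so it can be moved to the other
  -- side before taking suprema over `φ`.
  have hE : ∀ φ : (t : Fin (T + 1)) → E t, expect Q c
      ≤ ((m - ∑ t, (S t (φ t) - ∫ y, (φ t : Slice K t → ℝ) y ∂(marginal Q t)) : ℝ) : EReal) :=
    fun φ => by
      refine expect_le_of_forall_integral_le continuous_weight one_le_weight hw hlsc hA hlow
        fun g hg => ?_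
      have h2 := hL φ g hg
      rw [← (hQ _).2, ← (hQ _).2, integral_staticPayoff hEC hw] at h2
      rw [Finset.sum_sub_distrib]
      linarith
  have hbot : expect Q c ≠ ⊥ :=
    ((EReal.bot_lt_coe _).trans_le (integral_le_expect (hQ g₀).1 hg₀)).ne'
  have htop : expect Q c ≠ ⊤ := ((hE 0).trans_lt (EReal.coe_lt_top _)).ne
  lift expect Q c to ℝ using ⟨htop, hbot⟩ with e he
  have hpen : ∑ t, penalty (S t) (marginal Q t) ≤ ((m - e : ℝ) : EReal) :=
    sum_iSup_coe_le fun φ => by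
      have := EReal.coe_le_coe_iff.1 (hE φ)
      linarith
  calc (e : EReal) + ∑ t, penalty (S t) (marginal Q t) ≤ e + ((m - e : ℝ) : EReal) :=
        add_le_add_right hpen _
    _ = m := by rw [← EReal.coe_add, add_sub_cancel]

end

end EMOT

/-! ### The duality theorem -/

theorem theorem3p1 (T d : ℕ) (hd : 1 ≤ d)
    (K : Fin (T + 1) → Fin d → Set ℝ) (hK : ∀ t j, IsClosed (K t j))
    (E : (t : Fin (T + 1)) → Submodule ℝ (EMOT.Slice K t → ℝ))
    (hEC : ∀ t, E t ≤ EMOT.weightedC K t)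
    (h1 : ∀ t, (1 : EMOT.Slice K t → ℝ) ∈ E t)
    (hX : ∀ t j, (fun y : EMOT.Slice K t => (y j : ℝ)) ∈ E t)
    (S : (t : Fin (T + 1)) → E t → ℝ)
    (hconc : ∀ t, ConcaveOn ℝ Set.univ (S t))
    (hcash : ∀ t, EMOT.CashAdditive (h1 t) (S t))
    (hzero : ∀ t, S t 0 = 0)
    (htail : EMOT.TailControl (EMOT.additiveU S))
    (c : EMOT.Omega K → EReal) (hlsc : LowerSemicontinuous c)
    (hlow : ∃ A : ℝ, 0 ≤ A ∧
      ∀ x, ((-A * (1 + ∑ t, ∑ j, |(x t j : ℝ)|) : ℝ) : EReal) ≤ c x) :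
    EMOT.primalValue h1 (EMOT.additiveU S) (Set.range EMOT.stochInt) c =
        sSup {v : EReal | ∃ φ : (t : Fin (T + 1)) → E t,
          (∃ Δ : EMOT.Strategy K, ∀ x : EMOT.Omega K,
            ((∑ t, (φ t : EMOT.Slice K t → ℝ) (x t) + EMOT.stochInt Δ x : ℝ) : EReal) ≤ c x) ∧
          v = ((∑ t, S t (φ t) : ℝ) : EReal)} ∧
      sSup {v : EReal | ∃ φ : (t : Fin (T + 1)) → E t,
          (∃ Δ : EMOT.Strategy K, ∀ x : EMOT.Omega K,
            ((∑ t, (φ t : EMOT.Slice K t → ℝ) (x t) + EMOT.stochInt Δ x : ℝ) : EReal) ≤ c x) ∧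
          v = ((∑ t, S t (φ t) : ℝ) : EReal)} =
        ⨅ Q ∈ EMOT.Mart K,
          (EMOT.expect Q c + ∑ t, EMOT.penalty (S t) (EMOT.marginal Q t)) ∧
      (EMOT.primalValue h1 (EMOT.additiveU S) (Set.range EMOT.stochInt) c < ⊤ →
        ∃ Q ∈ EMOT.Mart K,
          EMOT.expect Q c + ∑ t, EMOT.penalty (S t) (EMOT.marginal Q t) =
            ⨅ Q' ∈ EMOT.Mart K,
              (EMOT.expect Q' c + ∑ t, EMOT.penalty (S t) (EMOT.marginal Q' t))) := by
  obtain ⟨A, hA, hlow⟩ := hlow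
  have hlow' : ∀ x, ((-(A * EMOT.weight K x) : ℝ) : EReal) ≤ c x := fun x => by
    rw [← neg_mul]
    exact hlow x
  rw [EMOT.primalValue_additiveU h1 hcash]
  generalize hP : sSup {v : EReal | ∃ φ : (t : Fin (T + 1)) → E t,
    (∃ Δ : EMOT.Strategy K, ∀ x : EMOT.Omega K,
      ((∑ t, (φ t : EMOT.Slice K t → ℝ) (x t) + EMOT.stochInt Δ x : ℝ) : EReal) ≤ c x) ∧
    v = ((∑ t, S t (φ t) : ℝ) : EReal)} = P
  have hle : ∀ (φ : (t : Fin (T + 1)) → E t) (Δ : EMOT.Strategy K),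
      (∀ x, ((∑ t, (φ t : EMOT.Slice K t → ℝ) (x t) + EMOT.stochInt Δ x : ℝ) : EReal) ≤ c x) →
        ((∑ t, S t (φ t) : ℝ) : EReal) ≤ P :=
    fun φ Δ h => hP ▸ le_sSup ⟨φ, ⟨Δ, h⟩, rfl⟩
  have hweak : ∀ Q ∈ EMOT.Mart K,
      P ≤ EMOT.expect Q c + ∑ t, EMOT.penalty (S t) (EMOT.marginal Q t) := fun Q hQ => by
    rw [← hP]
    refine sSup_le ?_
    rintro v ⟨φ, ⟨Δ, h⟩, rfl⟩
    exact EMOT.weak_duality hEC hQ h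
  have hinf := le_iInf₂ hweak
  have hattain : P < ⊤ → ∃ Q ∈ EMOT.Mart K,
      EMOT.expect Q c + ∑ t, EMOT.penalty (S t) (EMOT.marginal Q t) ≤ P := fun htop => by
    -- The growth bound on `c` and the tail instruments provide at least one subhedge, of real
    -- value.
    have hbot : P ≠ ⊥ := by
      obtain ⟨C, f, hC, hf0, hfC, -⟩ := htail
      obtain ⟨r, hr0, hr⟩ := EMOT.exists_dominating_level (hC 0) (hfC 0)
      obtain ⟨u, φ, Δ, -, h⟩ := EMOT.exists_mem_hedgeRelation (S := S) h1 (hf0 0) hr0 hr hA hlow' 0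
      exact ((EReal.bot_lt_coe _).trans_le (hle φ Δ fun x => by simpa using h x)).ne'
    lift P to ℝ using ⟨htop.ne, hbot⟩
    exact EMOT.exists_martingale_measure_le hK hEC h1 hconc hcash htail hlsc hA hlow'
      fun φ Δ h => EReal.coe_le_coe_iff.1 (hle φ Δ h)
  refine ⟨rfl, le_antisymm hinf ?_, fun htop => ?_⟩
  -- If `P = ⊤`, the inequality is trivial; otherwise the measure with dual value at most `P` bounds
  -- the infimum.
  · rcases eq_top_or_lt_top P with h | h
    · exact h ▸ le_top
    · obtain ⟨Q, hQ, hQP⟩ := hattain h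
      exact (iInf₂_le Q hQ).trans hQP
  · obtain ⟨Q, hQ, hQP⟩ := hattain htop
    exact ⟨Q, hQ, le_antisymm (hQP.trans hinf) (iInf₂_le Q hQ)⟩
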